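/- Write $|\cdot|$ for the Euclidean norm on $\mathbb R^N$, $B_j$ for the closed ball of radius $j$ centred at $0$, and $f_\tau(t,x)=f(t+\tau,x)$. All functions $f\colon\mathbb R\times\mathbb R^N\to\mathbb R^M$ below are Borel and have, for each compact $K\subset\mathbb R^N$, an $m$-bound on $K$, that is, a function $m^K\in L^1_{loc}$ with $|f(t,x)|\le m^K(t)$ for a.e. $t$ and all $x\in K$. Such an $f$ is in $\mathfrak{LC}$ if for each compact $K$ there is $l^K\in L^1_{loc}$ with $|f(t,x)-f(t,y)|\le l^K(t)|x-y|$ for a.e. $t$ and all $x,y\in K$; it is in $\mathfrak{SC}$ if $f(t,\cdot)$ is continuous for a.e. $t$. It has $L^1_{loc}$-equicontinuous $m$-bounds if for each $j\in\mathbb N$ there is a set $S$ of nonnegative functions in $L^1_{loc}$ that contains an $m$-bound on $B_j$ of every translate $f_\tau$, $\tau\in\mathbb R$, and is such that for all $r,\varepsilon>0$ there is $\delta>0$ with $\int_s^t m<\varepsilon$ for all $m\in S$ and all $-r\le s\le t\le r$ with $t-s<\delta$. Let $f\colon\mathbb R\times\mathbb R^N\to\mathbb R^N$ be in $\mathfrak{LC}$,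 continuously differentiable in $x$ for a.e. $t$, with $L^1_{loc}$-equicontinuous $m$-bounds and with Jacobian $J_xf\in\mathfrak{SC}(\mathbb R^{N\times N})$. Put $\theta_j(s)=\sup_{t\in\mathbb R}\int_t^{t+s}\sup_{x\in B_j}|f(u,x)|\,du$ and $\Theta=(\theta_j)_{j}$. For $I=[q_1,q_2]$ with rational endpoints let $\mathcal K_j^I$ be the set of continuous $x\colon I\to B_j$ with $|x(t)-x(s)|\le\theta_j(|t-s|)$ for $s,t\in I$. Say that $F\in\Theta\mathfrak C$ (resp. $F\in\mathfrak W\Theta\mathfrak C$) if, whenever $x_n\to x$ uniformly on $I$ with $x_n,x\in\mathcal K_j^I$, one has $\int_I|F(t,x_n(t))-F(t,x(t))|\,dt\to0$ (resp. $\int_IF(t,x_n(t))\,dt\to\int_IF(t,x(t))\,dt$). Functions lying in the same one of these spaces and equal a.e. are identified. Let $\mathcal T_\Theta$ be the topology generated by the seminorms $\sup_{x\in\mathcal K_j^I}\int_I|F(t,x(t))|\,dt$, and $\sigma_\Theta$ the one generated by the seminorms $\sup_{x\in\mathcal K_j^I}\bigl|\int_IF(t,x(t))\,dt\bigr|$.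 Consider either of two settings. Strong setting: $\mathbb H$ is the closure of $\{(f_\tau,(J_xf)_\tau):\tau\in\mathbb R\}$ in $(\mathfrak{LC}\times\Theta\mathfrak C,\mathcal T_\Theta\times\mathcal T_\Theta)$. Weak setting: $J_xf$ also has $L^1_{loc}$-equicontinuous $m$-bounds and $\mathbb H$ is the closure of the same set in $(\mathfrak{LC}\times\mathfrak W\Theta\mathfrak C,\sigma_\Theta\times\sigma_\Theta)$. Assume that for all $(g,G)\in\mathbb H$ and $x_0\in\mathbb R^N$ the Carathéodory solution $x(t,g,x_0)$ of $\dot x=g(t,x)$, $x(0)=x_0$, is defined for all $t\in\mathbb R$. Let $\Omega=\mathbb H\times\mathbb R^N$ with the product topology, and for $\omega=(g,G,x_0)\in\Omega$ put $\omega_t=(g_t,G_t,x(t,g,x_0))$ and $A(\omega)=\lim_{h\to0}\frac1h\int_0^hG(s,x(s,g,x_0))\,ds$ if the limit exists, $A(\omega)=0$ otherwise. (For a.e. $t$, $A(\omega_t)=G(t,x(t,g,x_0))$.) Let $\Phi(t,\omega)$ be the fundamental matrix solution of $\dot y=A(\omega_t)y$ with $\Phi(0,\omega)=\mathrm I_N$;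 the linearized skew-product flow is $(t,\omega,y_0)\mapsto(\omega_t,\Phi(t,\omega)y_0)$. For $J\in\{(-\infty,0],[0,\infty),\mathbb R\}$ and $\Delta\subset\Omega$, the flow has exponential dichotomy on $J$ over $\Delta$ if there are a continuous map $P\colon\Delta\to\mathcal L(\mathbb R^N,\mathbb R^N)$ whose values are projections and constants $K\ge1$, $\alpha>0$ such that for all $\omega\in\Delta$ and $s,t\in J$ $$\|\Phi(t,\omega)P(\omega)\Phi^{-1}(s,\omega)\|\le Ke^{-\alpha(t-s)}\ \text{ if } t\ge s,\qquad \|\Phi(t,\omega)(\mathrm I_N-P(\omega))\Phi^{-1}(s,\omega)\|\le Ke^{\alpha(t-s)}\ \text{ if } t\le s.$$ The single system $\dot y=A(\omega_t)y$ has exponential dichotomy on $J$ if this holds with $\Delta=\{\omega\}$. Let $\mathbb A(\omega)$ (resp. $\mathbb O(\omega)$) be the set of limits in $\Omega$ of sequences $\omega_{t_n}$ with $t_n\to-\infty$ (resp. $t_n\to+\infty$), and $\mathbb H(\omega)$ the closure in $\Omega$ of $\{\omega_t:t\in\mathbb R\}$. Then, in either setting, for every $\omega\in\Omega$: (i) if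 $\dot y=A(\omega_t)y$ has exponential dichotomy on $(-\infty,0]$, then the flow has exponential dichotomy on $\mathbb R$ over $\mathbb A(\omega)$; (ii) if $\dot y=A(\omega_t)y$ has exponential dichotomy on $[0,\infty)$, then the flow has exponential dichotomy on $\mathbb R$ over $\mathbb O(\omega)$; (iii) if $\dot y=A(\omega_t)y$ has exponential dichotomy on $\mathbb R$, then the flow has exponential dichotomy on $\mathbb R$ over $\mathbb H(\omega)$. -/

import Mathlib

open MeasureTheory Set Filter Topology

namespace CarathODE

/-- Euclidean space `ℝ^N`. -/
abbrev Euc (N : ℕ) : Type := EuclideanSpace ℝ (Fin N)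

/-- `N × N` real matrices, viewed as linear maps of `ℝ^N` (with the operator norm). -/
abbrev Mat (N : ℕ) : Type := Euc N →L[ℝ] Euc N

section Spaces

variable {N : ℕ} {V : Type*} [NormedAddCommGroup V] [NormedSpace ℝ V]

/-- `m` is an `m`-bound of `f` on `K`: a locally integrable function such that, for almost every
`t`, one has `‖f (t, x)‖ ≤ m t` for all `x ∈ K`. -/
def IsMBound (f : ℝ × Euc N → V) (K : Set (Euc N)) (m : ℝ → ℝ) : Prop :=
  LocallyIntegrable m ∧ ∀ᵐ t : ℝ, ∀ x ∈ K, ‖f (t, x)‖ ≤ m t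

lemma IsMBound.add {f g : ℝ × Euc N → V} {K : Set (Euc N)} {m n : ℝ → ℝ}
    (hf : IsMBound f K m) (hg : IsMBound g K n) : IsMBound (f + g) K (m + n) := by
  refine ⟨hf.1.add hg.1, ?_⟩
  filter_upwards [hf.2, hg.2] with t h1 h2 x hx
  exact (norm_add_le _ _).trans (add_le_add (h1 x hx) (h2 x hx))

lemma IsMBound.smul {f : ℝ × Euc N → V} {K : Set (Euc N)} {m : ℝ → ℝ}
    (c : ℝ) (hf : IsMBound f K m) : IsMBound (c • f) K (fun t => ‖c‖ * m t) := by
  refine ⟨hf.1.smul ‖c‖, ?_⟩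
  filter_upwards [hf.2] with t h1 x hx
  rw [Pi.smul_apply, norm_smul]
  exact mul_le_mul_of_nonneg_left (h1 x hx) (norm_nonneg c)

lemma IsMBound.shift {f : ℝ × Euc N → V} {K : Set (Euc N)} {m : ℝ → ℝ}
    (τ : ℝ) (hf : IsMBound f K m) :
    IsMBound (fun p => f (p.1 + τ, p.2)) K (fun t => m (t + τ)) := by
  have mp := measurePreserving_add_right (volume : Measure ℝ) τ
  refine ⟨?_, mp.quasiMeasurePreserving.ae hf.2⟩
  rw [locallyIntegrable_iff]
  intro k hk
  have hk' : IsCompact ((fun t : ℝ => t + τ) '' k) := hk.image (by fun_prop)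
  have h := hf.1.integrableOn_isCompact hk'
  have h2 := (mp.integrableOn_comp_preimage
    (Homeomorph.addRight τ).measurableEmbedding (f := m)).2 h
  exact h2.mono_set (subset_preimage_image _ _)

variable [MeasurableSpace V] [BorelSpace V] [SecondCountableTopology V]

variable (N V) in
/-- The vector space of Borel functions `f : ℝ × ℝ^N → V` having a locally integrable `m`-bound on
every compact set. -/
def carSubmodule : Submodule ℝ (ℝ × Euc N → V) where
  carrier := {f | Measurable f ∧ ∀ K : Set (Euc N), IsCompact K → ∃ m, IsMBound f K m}
  add_mem' := by
    rintro f g ⟨hf, hf'⟩ ⟨hg, hg'⟩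
    refine ⟨hf.add hg, fun K hK => ?_⟩
    obtain ⟨m, hm⟩ := hf' K hK
    obtain ⟨n, hn⟩ := hg' K hK
    exact ⟨_, hm.add hn⟩
  zero_mem' := ⟨measurable_const, fun K _ => ⟨0, locallyIntegrable_zero,
    by filter_upwards with t x _; simp⟩⟩
  smul_mem' := by
    rintro c f ⟨hf, hf'⟩
    refine ⟨hf.const_smul c, fun K hK => ?_⟩
    obtain ⟨m, hm⟩ := hf' K hK
    exact ⟨_, hm.smul c⟩

variable (N V) in
/-- The space `𝔠` of functions `ℝ × ℝ^N → V` satisfying (C1) Borel measurability and (C2) existence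
of locally integrable `m`-bounds on compact sets. It carries no canonical topology; the topologies
in use are introduced explicitly below. Elements are genuine functions; two of them lying in one of
the subspaces below and agreeing almost everywhere are topologically indistinguishable there. -/
def Car : Type _ := carSubmodule N V

noncomputable instance : AddCommGroup (Car N V) := inferInstanceAs (AddCommGroup (carSubmodule N V))

noncomputable instance : Module ℝ (Car N V) := inferInstanceAs (Module ℝ (carSubmodule N V))

instance : CoeFun (Car N V) (fun _ => ℝ × Euc N → V) := ⟨fun f => f.1⟩

lemma Car.add_apply (f g : Car N V) (p : ℝ × Euc N) : (f + g) p = f p + g p := rfl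

lemma Car.smul_apply (c : ℝ) (f : Car N V) (p : ℝ × Euc N) : (c • f) p = c • f p := rfl

/-- The time translation `f_τ (t, x) = f (t + τ, x)`. -/
def Car.shift (τ : ℝ) (f : Car N V) : Car N V :=
  ⟨fun p => f (p.1 + τ, p.2), f.2.1.comp (by fun_prop), fun K hK =>
    let ⟨m, hm⟩ := f.2.2 K hK
    ⟨_, hm.shift τ⟩⟩

/-- Lipschitz Carathéodory functions: local Lipschitz constants in `x` are locally integrable. -/
def IsLC (f : Car N V) : Prop :=
  ∀ K : Set (Euc N), IsCompact K → ∃ l : ℝ → ℝ, LocallyIntegrable l ∧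
    ∀ᵐ t : ℝ, ∀ x ∈ K, ∀ y ∈ K, ‖f (t, x) - f (t, y)‖ ≤ l t * ‖x - y‖

/-- Strong Carathéodory functions. -/
def IsSC (f : Car N V) : Prop := ∀ᵐ t : ℝ, Continuous fun x => f (t, x)

/-- The set `𝒦_j^I`, `I = [q₁, q₂]`, of continuous functions `x : I → B_j` admitting `Θ j` as a
modulus of continuity (functions are regarded on all of `ℝ`, only their values on `I` matter). -/
def modSet (N : ℕ) (Θ : ℕ → ℝ → ℝ) (q : ℚ × ℚ) (j : ℕ) : Set (ℝ → Euc N) :=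
  {x | ContinuousOn x (Icc (q.1 : ℝ) q.2) ∧
    (∀ t ∈ Icc (q.1 : ℝ) q.2, x t ∈ Metric.closedBall (0 : Euc N) j) ∧
    ∀ s ∈ Icc (q.1 : ℝ) q.2, ∀ t ∈ Icc (q.1 : ℝ) q.2, ‖x t - x s‖ ≤ Θ j |t - s|}

/-- `Θ`-Carathéodory functions. -/
def IsTC (Θ : ℕ → ℝ → ℝ) (f : Car N V) : Prop :=
  ∀ (q : ℚ × ℚ) (j : ℕ) (x : ℕ → ℝ → Euc N) (y : ℝ → Euc N),
    (∀ n, x n ∈ modSet N Θ q j) → y ∈ modSet N Θ q j →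
    TendstoUniformlyOn x y atTop (Icc (q.1 : ℝ) q.2) →
    Tendsto (fun n => ∫ t in Icc (q.1 : ℝ) q.2, ‖f (t, x n t) - f (t, y t)‖) atTop (𝓝 0)

/-- Weak `Θ`-Carathéodory functions. -/
def IsWTC (Θ : ℕ → ℝ → ℝ) (f : Car N V) : Prop :=
  ∀ (q : ℚ × ℚ) (j : ℕ) (x : ℕ → ℝ → Euc N) (y : ℝ → Euc N),
    (∀ n, x n ∈ modSet N Θ q j) → y ∈ modSet N Θ q j →
    TendstoUniformlyOn x y atTop (Icc (q.1 : ℝ) q.2) →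
    Tendsto (fun n => ∫ t in Icc (q.1 : ℝ) q.2, f (t, x n t)) atTop
      (𝓝 (∫ t in Icc (q.1 : ℝ) q.2, f (t, y t)))

lemma Car.exists_bound (f : Car N V) (Θ : ℕ → ℝ → ℝ) (q : ℚ × ℚ) (j : ℕ) :
    ∃ C : ℝ, ∀ x ∈ modSet N Θ q j,
      IntegrableOn (fun t => f (t, x t)) (Icc (q.1 : ℝ) q.2) ∧
      ∫ t in Icc (q.1 : ℝ) q.2, ‖f (t, x t)‖ ≤ C := by
  obtain ⟨m, hm, hb⟩ := f.2.2 (Metric.closedBall (0 : Euc N) j) (isCompact_closedBall _ _)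
  have hmi : IntegrableOn m (Icc (q.1 : ℝ) q.2) := hm.integrableOn_isCompact isCompact_Icc
  refine ⟨∫ t in Icc (q.1 : ℝ) q.2, m t, fun x hx => ?_⟩
  have hb' : ∀ᵐ t ∂(volume.restrict (Icc (q.1 : ℝ) q.2)), ‖f (t, x t)‖ ≤ m t := by
    filter_upwards [ae_restrict_of_ae hb, ae_restrict_mem measurableSet_Icc] with t h1 h2
    exact h1 _ (hx.2.1 t h2)
  have hxm : AEMeasurable x (volume.restrict (Icc (q.1 : ℝ) q.2)) :=
    hx.1.aemeasurable measurableSet_Icc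
  have hi : IntegrableOn (fun t => f (t, x t)) (Icc (q.1 : ℝ) q.2) :=
    Integrable.mono' hmi
      ((f.2.1.comp_aemeasurable (aemeasurable_id.prodMk hxm)).aestronglyMeasurable) hb'
  exact ⟨hi, integral_mono_ae hi.norm hmi hb'⟩

/-- The seminorm `f ↦ sup_{x ∈ 𝒦_j^I} |∫_I f(t, x(t)) dt|`. -/
noncomputable def weakSeminorm (N : ℕ) (V : Type*) [NormedAddCommGroup V] [NormedSpace ℝ V]
    [MeasurableSpace V] [BorelSpace V] [SecondCountableTopology V]
    (Θ : ℕ → ℝ → ℝ) (i : (ℚ × ℚ) × ℕ) : Seminorm ℝ (Car N V) :=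
  Seminorm.of
    (fun f => ⨆ x : modSet N Θ i.1 i.2,
      ‖∫ t in Icc (i.1.1 : ℝ) i.1.2, f (t, (x : ℝ → Euc N) t)‖)
    (by
      intro f g
      have key : ∀ h : Car N V, BddAbove (range fun x : modSet N Θ i.1 i.2 =>
          ‖∫ t in Icc (i.1.1 : ℝ) i.1.2, h (t, (x : ℝ → Euc N) t)‖) := by
        intro h
        obtain ⟨C, hC⟩ := h.exists_bound Θ i.1 i.2
        refine ⟨C, ?_⟩
        rintro _ ⟨x, rfl⟩
        exact (norm_integral_le_integral_norm _).trans (hC x x.2).2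
      refine Real.iSup_le (fun x => ?_) (add_nonneg (Real.iSup_nonneg fun _ => norm_nonneg _)
        (Real.iSup_nonneg fun _ => norm_nonneg _))
      obtain ⟨_, hf⟩ := f.exists_bound Θ i.1 i.2
      obtain ⟨_, hg⟩ := g.exists_bound Θ i.1 i.2
      simp only [Car.add_apply]
      rw [integral_add (hf x x.2).1 (hg x x.2).1]
      exact (norm_add_le _ _).trans (add_le_add (le_ciSup (key f) x) (le_ciSup (key g) x)))
    (by
      intro c f
      simp only [Car.smul_apply, integral_smul, norm_smul]
      rw [Real.mul_iSup_of_nonneg (norm_nonneg c)])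

/-- The seminorm `f ↦ sup_{x ∈ 𝒦_j^I} ∫_I |f(t, x(t))| dt`. -/
noncomputable def strongSeminorm (N : ℕ) (V : Type*) [NormedAddCommGroup V] [NormedSpace ℝ V]
    [MeasurableSpace V] [BorelSpace V] [SecondCountableTopology V]
    (Θ : ℕ → ℝ → ℝ) (i : (ℚ × ℚ) × ℕ) : Seminorm ℝ (Car N V) :=
  Seminorm.of
    (fun f => ⨆ x : modSet N Θ i.1 i.2,
      ∫ t in Icc (i.1.1 : ℝ) i.1.2, ‖f (t, (x : ℝ → Euc N) t)‖)
    (by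
      intro f g
      have key : ∀ h : Car N V, BddAbove (range fun x : modSet N Θ i.1 i.2 =>
          ∫ t in Icc (i.1.1 : ℝ) i.1.2, ‖h (t, (x : ℝ → Euc N) t)‖) := by
        intro h
        obtain ⟨C, hC⟩ := h.exists_bound Θ i.1 i.2
        refine ⟨C, ?_⟩
        rintro _ ⟨x, rfl⟩
        exact (hC x x.2).2
      have nn : ∀ (h : Car N V) (x : modSet N Θ i.1 i.2),
          0 ≤ ∫ t in Icc (i.1.1 : ℝ) i.1.2, ‖h (t, (x : ℝ → Euc N) t)‖ :=
        fun h x => integral_nonneg fun _ => norm_nonneg _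
      refine Real.iSup_le (fun x => ?_) (add_nonneg (Real.iSup_nonneg (nn f))
        (Real.iSup_nonneg (nn g)))
      obtain ⟨_, hf⟩ := f.exists_bound Θ i.1 i.2
      obtain ⟨_, hg⟩ := g.exists_bound Θ i.1 i.2
      refine le_trans ?_ (add_le_add (le_ciSup (key f) x) (le_ciSup (key g) x))
      rw [← integral_add (hf x x.2).1.norm (hg x x.2).1.norm]
      refine integral_mono ((hf x x.2).1.add (hg x x.2).1).norm
        ((hf x x.2).1.norm.add (hg x x.2).1.norm) (fun t => ?_)
      exact norm_add_le _ _)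
    (by
      intro c f
      simp only [Car.smul_apply, norm_smul, integral_const_mul]
      rw [Real.mul_iSup_of_nonneg (norm_nonneg c)])

/-- The two settings: the strong topology `𝒯_Θ` (with the space `ΘC`) or the weak topology `σ_Θ`
(with the space `WΘC`). -/
inductive Mode
  | strong
  | weak

/-- The family of seminorms generating the topology of the given setting. -/
noncomputable def seminorms (mode : Mode) (N : ℕ) (V : Type*) [NormedAddCommGroup V]
    [NormedSpace ℝ V] [MeasurableSpace V] [BorelSpace V] [SecondCountableTopology V]
    (Θ : ℕ → ℝ → ℝ) : SeminormFamily ℝ (Car N V) ((ℚ × ℚ) × ℕ) :=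
  match mode with
  | .strong => strongSeminorm N V Θ
  | .weak => weakSeminorm N V Θ

/-- The topology `𝒯_Θ` (strong) or `σ_Θ` (weak) on `Car N V`. -/
@[reducible] noncomputable def carTopology (mode : Mode) (Θ : ℕ → ℝ → ℝ) (N : ℕ) (V : Type*)
    [NormedAddCommGroup V] [NormedSpace ℝ V] [MeasurableSpace V] [BorelSpace V]
    [SecondCountableTopology V] : TopologicalSpace (Car N V) :=
  (seminorms mode N V Θ).moduleFilterBasis.topology

/-- Membership in `ΘC` (strong setting) or `WΘC` (weak setting). -/
def IsThetaC (mode : Mode) (Θ : ℕ → ℝ → ℝ) (f : Car N V) : Prop :=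
  match mode with
  | .strong => IsTC Θ f
  | .weak => IsWTC Θ f

/-- `L¹_loc`-equicontinuity of a set of locally integrable functions. -/
def L1locEquicontinuous (S : Set (ℝ → ℝ)) : Prop :=
  ∀ r > (0 : ℝ), ∀ ε > (0 : ℝ), ∃ δ > (0 : ℝ), ∀ s t : ℝ, -r ≤ s → s ≤ t → t ≤ r → t - s < δ →
    ∀ m ∈ S, ∫ u in s..t, m u < ε

/-- `f` has `L¹_loc`-equicontinuous `m`-bounds: for each `j` the translates of `f` admit `m`-bounds
on `B_j` forming an `L¹_loc`-equicontinuous set of nonnegative functions. -/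
def HasEquicontinuousMBounds (f : Car N V) : Prop :=
  ∀ j : ℕ, ∃ S : Set (ℝ → ℝ),
    (∀ m ∈ S, LocallyIntegrable m ∧ ∀ᵐ t : ℝ, 0 ≤ m t) ∧
    (∀ τ : ℝ, ∃ m ∈ S, IsMBound (f.shift τ) (Metric.closedBall (0 : Euc N) j) m) ∧
    L1locEquicontinuous S

/-- The optimal `m`-bound of `f` on the ball `B_j`. -/
noncomputable def optMBound (f : Car N V) (j : ℕ) (t : ℝ) : ℝ :=
  ⨆ x : Metric.closedBall (0 : Euc N) j, ‖f (t, (x : Euc N))‖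

/-- The moduli of continuity `θ_j(s) = sup_t ∫_t^{t+s} m^j(u) du` determined by the optimal
`m`-bounds of `f`. -/
noncomputable def theta (f : Car N V) (j : ℕ) (s : ℝ) : ℝ :=
  ⨆ t : ℝ, ∫ u in t..(t + s), optMBound f j u

end Spaces

section Flow

variable {N : ℕ}

/-- `f` is continuously differentiable in `x` for a.e. `t`, and `F` is its Jacobian in `x`. -/
def IsJacobian (f : Car N (Euc N)) (F : Car N (Mat N)) : Prop :=
  ∀ᵐ t : ℝ, ContDiff ℝ 1 (fun x => f (t, x)) ∧ ∀ x, F (t, x) = fderiv ℝ (fun x => f (t, x)) x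

/-- Global Carathéodory solutions of `ẋ = g(t, x)`, `x(0) = x₀`. -/
def IsSolution (g : Car N (Euc N)) (x₀ : Euc N) (x : ℝ → Euc N) : Prop :=
  Continuous x ∧ ∀ t, x t = x₀ + ∫ s in (0 : ℝ)..t, g (s, x s)

open Classical in
/-- The solution `x(·, g, x₀)`, if it is globally defined. -/
noncomputable def sol (g : Car N (Euc N)) (x₀ : Euc N) : ℝ → Euc N :=
  if h : ∃ x, IsSolution g x₀ x then h.choose else 0

variable (N) in
/-- Triples `(g, G, x₀)`. -/
abbrev Triple : Type := Car N (Euc N) × Car N (Mat N) × Euc N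

/-- The product topology on pairs `(g, G)` in the given setting. -/
@[reducible] noncomputable def pairTopology (mode : Mode) (Θ : ℕ → ℝ → ℝ) (N : ℕ) :
    TopologicalSpace (Car N (Euc N) × Car N (Mat N)) :=
  @instTopologicalSpaceProd _ _ (carTopology mode Θ N (Euc N)) (carTopology mode Θ N (Mat N))

/-- The product topology on triples `(g, G, x₀)` in the given setting. -/
@[reducible] noncomputable def tripleTopology (mode : Mode) (Θ : ℕ → ℝ → ℝ) (N : ℕ) :
    TopologicalSpace (Triple N) :=
  @instTopologicalSpaceProd _ _ (carTopology mode Θ N (Euc N))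
    (@instTopologicalSpaceProd _ _ (carTopology mode Θ N (Mat N)) inferInstance)

/-- The hull of `(f, F)`: the closure in `LC × ΘC` (strong) or `LC × WΘC` (weak) of the set of
translates `(f_τ, F_τ)`, where `Θ` is given by the optimal `m`-bounds of `f`. -/
def hull (mode : Mode) (f : Car N (Euc N)) (F : Car N (Mat N)) :
    Set (Car N (Euc N) × Car N (Mat N)) :=
  {p | IsLC p.1 ∧ IsThetaC mode (theta f) p.2 ∧
    p ∈ @closure _ (pairTopology mode (theta f) N) (range fun τ : ℝ => (f.shift τ, F.shift τ))}

/-- The base space `Ω = hull × ℝ^N` of the linearized skew-product flow. -/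
def Omega (mode : Mode) (f : Car N (Euc N)) (F : Car N (Mat N)) : Set (Triple N) :=
  {ω | (ω.1, ω.2.1) ∈ hull mode f F}

/-- The base flow `ω_t = (g_t, G_t, x(t, g, x₀))`. -/
noncomputable def baseFlow (t : ℝ) (ω : Triple N) : Triple N :=
  (ω.1.shift t, ω.2.1.shift t, sol ω.1 ω.2.2 t)

open Classical in
/-- `A(ω) = lim_{h → 0} h⁻¹ ∫_0^h G(s, x(s, g, x₀)) ds` if the limit exists, and `0` otherwise. -/
noncomputable def coeffA (ω : Triple N) : Mat N :=
  if h : ∃ L : Mat N, Tendsto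
      (fun h : ℝ => h⁻¹ • ∫ s in (0 : ℝ)..h, ω.2.1 (s, sol ω.1 ω.2.2 s)) (𝓝[≠] 0) (𝓝 L)
  then h.choose else 0

/-- `Φ` is a (Carathéodory) fundamental matrix solution of `ẏ = A(ω_t) y` with `Φ(0) = I`. -/
def IsFundamental (ω : Triple N) (Φ : ℝ → Mat N) : Prop :=
  Continuous Φ ∧ ∀ t, Φ t = 1 + ∫ s in (0 : ℝ)..t, coeffA (baseFlow s ω) * Φ s

open Classical in
/-- The fundamental matrix solution `Φ(t, ω)` of `ẏ = A(ω_t) y` with `Φ(0, ω) = I`. -/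
noncomputable def fundMat (t : ℝ) (ω : Triple N) : Mat N :=
  if h : ∃ Φ, IsFundamental ω Φ then h.choose t else 1

/-- The family `ẏ = A(ω_t) y`, equivalently the linear skew-product flow, has exponential dichotomy
on `I` over `Δ`, with projections depending continuously on `ω ∈ Δ`. -/
def HasExpDichotomy (mode : Mode) (Θ : ℕ → ℝ → ℝ) (I : Set ℝ) (Δ : Set (Triple N)) : Prop :=
  ∃ P : Triple N → Mat N,
    @ContinuousOn _ _ (tripleTopology mode Θ N) inferInstance P Δ ∧
    (∀ ω ∈ Δ, IsIdempotentElem (P ω)) ∧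
    ∃ K : ℝ, 1 ≤ K ∧ ∃ α : ℝ, 0 < α ∧ ∀ s ∈ I, ∀ t ∈ I, ∀ ω ∈ Δ,
      (s ≤ t → ‖fundMat t ω * P ω * Ring.inverse (fundMat s ω)‖ ≤ K * Real.exp (-α * (t - s))) ∧
      (t ≤ s → ‖fundMat t ω * (1 - P ω) * Ring.inverse (fundMat s ω)‖
        ≤ K * Real.exp (α * (t - s)))

/-- The alpha limit set of `ω` in `Ω`. -/
def alphaLimit (mode : Mode) (f : Car N (Euc N)) (F : Car N (Mat N)) (ω : Triple N) :
    Set (Triple N) :=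
  {ω' | ω' ∈ Omega mode f F ∧ ∃ t : ℕ → ℝ, Tendsto t atTop atBot ∧
    Tendsto (fun n => baseFlow (t n) ω) atTop (@nhds _ (tripleTopology mode (theta f) N) ω')}

/-- The omega limit set of `ω` in `Ω`. -/
def omegaLimit (mode : Mode) (f : Car N (Euc N)) (F : Car N (Mat N)) (ω : Triple N) :
    Set (Triple N) :=
  {ω' | ω' ∈ Omega mode f F ∧ ∃ t : ℕ → ℝ, Tendsto t atTop atTop ∧
    Tendsto (fun n => baseFlow (t n) ω) atTop (@nhds _ (tripleTopology mode (theta f) N) ω')}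

/-- The hull of `ω`: the closure in `Ω` of its orbit. -/
def orbitHull (mode : Mode) (f : Car N (Euc N)) (F : Car N (Mat N)) (ω : Triple N) :
    Set (Triple N) :=
  {ω' | ω' ∈ Omega mode f F ∧
    ω' ∈ @closure _ (tripleTopology mode (theta f) N) (range fun t : ℝ => baseFlow t ω)}

end Flow

end CarathODE

/-!
Every `(g, G, x₀) ∈ Ω` is a limit of translates, so `g` (in the weak setting also `G` along
admissible curves) inherits `m`-bounds whose integrals are controlled by the moduli of the
translates. Hence the solutions `x(·, g, x₀)` have the very moduli of continuity `θ_j` that enter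
the seminorms, and convergence in `Ω` yields locally uniform convergence of solutions. The
coefficients `s ↦ G(s, x(s, g, x₀))` then have convergent primitives and are equi-integrable, and a
Grönwall argument shows that `Φ(t, ω)` depends continuously on `ω`, although the coefficients
converge only weakly.

If `ẏ = A(ω_t) y` has an exponential dichotomy with projection `P`, the projections
`Φ(τ, ω) P Φ(τ, ω)⁻¹` give dichotomies at `ω_τ` with the same constants on translated time sets,
hence are bounded. At a limit point of the orbit at which the translated sets exhaust `ℝ`, any of
their ultrafilter limits is the projection of a dichotomy on `ℝ`. Such a projection is unique, and
with compactness this makes it a continuous function of the limit point.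
-/

namespace CarathODE

section Gronwall

lemma intervalIntegrable_of_locallyIntegrable {E : Type*} [NormedAddCommGroup E] {f : ℝ → E}
    (hf : LocallyIntegrable f) (a b : ℝ) : IntervalIntegrable f volume a b :=
  (hf.integrableOn_isCompact isCompact_uIcc).intervalIntegrable

lemma locallyIntegrable_norm {X E : Type*} [TopologicalSpace X] [MeasurableSpace X]
    [NormedAddCommGroup E] {μ : Measure X} {f : X → E} (hf : LocallyIntegrable f μ) :
    LocallyIntegrable (fun t => ‖f t‖) μ :=
  fun t => (hf t).norm

lemma continuous_integral_of_locallyIntegrable {E : Type*} [NormedAddCommGroup E]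
    [NormedSpace ℝ E] {f : ℝ → E} (hf : LocallyIntegrable f) (a : ℝ) :
    Continuous fun t => ∫ u in a..t, f u :=
  intervalIntegral.continuous_primitive (intervalIntegrable_of_locallyIntegrable hf) a

lemma abs_le_abs_of_mem_uIoc_zero {s t : ℝ} (h : s ∈ uIoc 0 t) : |s| ≤ |t| := by
  simpa using abs_sub_left_of_mem_uIcc (uIoc_subset_uIcc h)

/-- The weight of the Bielecki norm: the linear integral operator `u ↦ ∫₀ᵗ l u` halves the norm
`sup |u| / bieleckiWeight l`, which makes it a contraction on unbounded time intervals. -/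
noncomputable def bieleckiWeight (l : ℝ → ℝ) (t : ℝ) : ℝ :=
  Real.exp (2 * |∫ u in (0 : ℝ)..t, l u|)

lemma bieleckiWeight_pos (l : ℝ → ℝ) (t : ℝ) : 0 < bieleckiWeight l t := Real.exp_pos _

lemma one_le_bieleckiWeight (l : ℝ → ℝ) (t : ℝ) : 1 ≤ bieleckiWeight l t :=
  Real.one_le_exp (by positivity)

lemma bieleckiWeight_neg (l : ℝ → ℝ) (t : ℝ) :
    bieleckiWeight l (-t) = bieleckiWeight (fun s => l (-s)) t := by
  rw [bieleckiWeight, bieleckiWeight, intervalIntegral.integral_comp_neg, neg_zero,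
    intervalIntegral.integral_symm, abs_neg]

lemma continuous_bieleckiWeight {l : ℝ → ℝ} (hl : LocallyIntegrable l) :
    Continuous (bieleckiWeight l) := by
  have := continuous_integral_of_locallyIntegrable hl 0
  unfold bieleckiWeight
  fun_prop

lemma intervalIntegrable_mul_bieleckiWeight {l : ℝ → ℝ} (hl : LocallyIntegrable l) (a b : ℝ) :
    IntervalIntegrable (fun s => l s * bieleckiWeight l s) volume a b :=
  intervalIntegrable_of_locallyIntegrable (hl.mul_continuous (continuous_bieleckiWeight hl)) a b

lemma integral_mul_bieleckiWeight_le {l : ℝ → ℝ} (hl : LocallyIntegrable l) (h0 : ∀ t, 0 ≤ l t)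
    {t : ℝ} (ht : 0 ≤ t) :
    ∫ s in (0 : ℝ)..t, l s * bieleckiWeight l s ≤ bieleckiWeight l t / 2 := by
  set a : ℝ → ℝ := fun s => ∫ u in (0 : ℝ)..s, l u
  have ha0 : a 0 = 0 := intervalIntegral.integral_same
  have ha : Monotone a := fun x y hxy => by
    rw [← sub_nonneg, intervalIntegral.integral_interval_sub_left
      (intervalIntegrable_of_locallyIntegrable hl 0 y)
      (intervalIntegrable_of_locallyIntegrable hl 0 x)]
    exact intervalIntegral.integral_nonneg hxy fun u _ => h0 u
  have hweight : ∀ s, 0 ≤ s → bieleckiWeight l s = Real.exp (2 * a s) := fun s hs => by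
    rw [bieleckiWeight, abs_of_nonneg (ha0.symm.le.trans (ha hs))]
  have hmono : Monotone fun s => Real.exp (2 * a s) / 2 := fun x y hxy => by
    have := ha hxy
    dsimp only
    gcongr
  have hderiv : ∫ s in (0 : ℝ)..t, l s * bieleckiWeight l s =
      ∫ s in (0 : ℝ)..t, deriv (fun s => Real.exp (2 * a s) / 2) s := by
    apply intervalIntegral.integral_congr_ae
    filter_upwards [_root_.LocallyIntegrable.ae_hasDerivAt_integral hl] with s hs hst
    rw [uIoc_of_le ht] at hst
    rw [(((hs 0).const_mul 2).exp.div_const 2).deriv, hweight s hst.1.le]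
    ring
  have hFTC := (hmono.monotoneOn (uIcc 0 t)).intervalIntegral_deriv_mem_uIcc
  rw [uIcc_of_le (sub_nonneg.2 (hmono ht)), ← hderiv] at hFTC
  rw [hweight t ht]
  exact hFTC.2.trans (sub_le_self _ (by positivity))

lemma abs_integral_mul_bieleckiWeight_le {l : ℝ → ℝ} (hl : LocallyIntegrable l)
    (h0 : ∀ t, 0 ≤ l t) (t : ℝ) :
    |∫ s in (0 : ℝ)..t, l s * bieleckiWeight l s| ≤ bieleckiWeight l t / 2 := by
  wlog ht : 0 ≤ t generalizing l t
  · have hl' : LocallyIntegrable fun s => l (-s) :=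
      (locallyIntegrable_map_homeomorph (Homeomorph.neg ℝ)).1
        ((Measure.map_neg_eq_self (volume : Measure ℝ)).symm ▸ hl)
    have h := this hl' (fun s => h0 _) (-t) (by linarith)
    simp only [← bieleckiWeight_neg, neg_neg] at h
    rwa [intervalIntegral.integral_comp_neg fun s => l s * bieleckiWeight l s, neg_neg, neg_zero,
      intervalIntegral.integral_symm, abs_neg] at h
  · rw [abs_of_nonneg (intervalIntegral.integral_nonneg ht fun s _ =>
      mul_nonneg (h0 s) (bieleckiWeight_pos l s).le)]
    exact integral_mul_bieleckiWeight_le hl h0 ht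

lemma norm_integral_le_mul_bieleckiWeight {E : Type*} [NormedAddCommGroup E] [NormedSpace ℝ E]
    {l : ℝ → ℝ} (hl : LocallyIntegrable l) (h0 : ∀ t, 0 ≤ l t) {f : ℝ → E} {M t : ℝ} (hM : 0 ≤ M)
    (hf : ∀ s, |s| ≤ |t| → ‖f s‖ ≤ M * (l s * bieleckiWeight l s)) :
    ‖∫ s in (0 : ℝ)..t, f s‖ ≤ M * (bieleckiWeight l t / 2) := by
  have hle : ‖∫ s in (0 : ℝ)..t, f s‖ ≤
      |∫ s in (0 : ℝ)..t, M * (l s * bieleckiWeight l s)| := by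
    refine intervalIntegral.norm_integral_le_abs_of_norm_le ?_
      ((intervalIntegrable_mul_bieleckiWeight hl 0 t).const_mul M)
    filter_upwards [ae_restrict_mem measurableSet_uIoc] with s hs
    exact hf s (abs_le_abs_of_mem_uIoc_zero hs)
  rw [intervalIntegral.integral_const_mul, abs_mul, abs_of_nonneg hM] at hle
  exact hle.trans (mul_le_mul_of_nonneg_left (abs_integral_mul_bieleckiWeight_le hl h0 t) hM)

lemma le_mul_bieleckiWeight_of_le_add_integral {l u : ℝ → ℝ} {ε T : ℝ}
    (hl : LocallyIntegrable l) (h0 : ∀ t, 0 ≤ l t) (hu : Continuous u) (hu0 : ∀ t, 0 ≤ u t)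
    (h : ∀ t, |t| ≤ T → u t ≤ ε + |∫ s in (0 : ℝ)..t, l s * u s|) {t : ℝ} (ht : |t| ≤ T) :
    u t ≤ 2 * ε * bieleckiWeight l t := by
  have hpos := bieleckiWeight_pos l
  obtain ⟨s₀, hs₀, hmax⟩ := (isCompact_Icc (a := -T) (b := T)).exists_isMaxOn ⟨t, abs_le.1 ht⟩
    (hu.div (continuous_bieleckiWeight hl) fun s => (hpos s).ne').continuousOn
  set M := u s₀ / bieleckiWeight l s₀
  have hM0 : 0 ≤ M := div_nonneg (hu0 _) (hpos _).le
  have hle : ∀ s, |s| ≤ T → u s ≤ M * bieleckiWeight l s := fun s hs =>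
    (div_le_iff₀ (hpos s)).1 (hmax (abs_le.1 hs))
  have hint : |∫ s in (0 : ℝ)..s₀, l s * u s| ≤ M * (bieleckiWeight l s₀ / 2) :=
    norm_integral_le_mul_bieleckiWeight hl h0 hM0 fun s hs => by
      rw [Real.norm_eq_abs, abs_of_nonneg (mul_nonneg (h0 s) (hu0 s)), mul_left_comm]
      exact mul_le_mul_of_nonneg_left (hle s (hs.trans (abs_le.2 hs₀))) (h0 s)
  have hs₀M : M * bieleckiWeight l s₀ ≤ 2 * ε := by
    have hu₀ : u s₀ = M * bieleckiWeight l s₀ := (div_mul_cancel₀ _ (hpos s₀).ne').symm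
    linarith [h s₀ (abs_le.2 hs₀)]
  have hM2 : M ≤ 2 * ε := (le_mul_of_one_le_right hM0 (one_le_bieleckiWeight l s₀)).trans hs₀M
  exact (hle t ht).trans (mul_le_mul_of_nonneg_right hM2 (hpos t).le)

end Gronwall

section Linear

open scoped BoundedContinuousFunction

variable {R : Type*} [NormedRing R]

lemma intervalIntegrable_mul_continuous {A Φ : ℝ → R} (hA : LocallyIntegrable A)
    (hΦ : Continuous Φ) (a b : ℝ) : IntervalIntegrable (fun s => A s * Φ s) volume a b :=
  intervalIntegrable_of_locallyIntegrable (hA.mul_continuous hΦ) a b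

variable [NormedAlgebra ℝ R]

/-- `Φ` is the principal solution of the linear equation with coefficient `A`: it solves
`Φ' = A Φ`, `Φ(0) = 1` in the integral (Carathéodory) sense on the whole line. -/
def IsPrincipal (A Φ : ℝ → R) : Prop :=
  Continuous Φ ∧ ∀ t, Φ t = 1 + ∫ s in (0 : ℝ)..t, A s * Φ s

lemma integral_mul_const_of_locallyIntegrable [CompleteSpace R] {A : ℝ → R}
    (hA : LocallyIntegrable A) (C : R) (a b : ℝ) :
    ∫ s in a..b, A s * C = (∫ s in a..b, A s) * C :=
  ((ContinuousLinearMap.mul ℝ R).flip C).intervalIntegral_comp_comm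
    (intervalIntegrable_of_locallyIntegrable hA a b)

lemma norm_integral_mul_weight_smul_le {A : ℝ → R} (hA : LocallyIntegrable A) (Ψ : ℝ →ᵇ R)
    (t : ℝ) :
    ‖∫ s in (0 : ℝ)..t, A s * (bieleckiWeight (‖A ·‖) s • Ψ s)‖ ≤
      ‖Ψ‖ * (bieleckiWeight (‖A ·‖) t / 2) := by
  refine norm_integral_le_mul_bieleckiWeight (locallyIntegrable_norm hA) (fun _ => norm_nonneg _)
    (norm_nonneg Ψ) fun s _ => ?_
  calc ‖A s * (bieleckiWeight (‖A ·‖) s • Ψ s)‖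
      ≤ ‖A s‖ * (bieleckiWeight (‖A ·‖) s * ‖Ψ s‖) := by
        simpa only [norm_smul, Real.norm_of_nonneg (bieleckiWeight_pos _ s).le] using
          norm_mul_le (A s) (bieleckiWeight (‖A ·‖) s • Ψ s)
    _ ≤ ‖A s‖ * (bieleckiWeight (‖A ·‖) s * ‖Ψ‖) := by
        have := (bieleckiWeight_pos (‖A ·‖) s).le
        gcongr
        exact Ψ.norm_coe_le_norm s
    _ = ‖Ψ‖ * (‖A s‖ * bieleckiWeight (‖A ·‖) s) := by ring

/-- The Picard operator `Φ ↦ 1 + ∫₀ᵗ A Φ`, written for the bounded function `Ψ` with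
`Φ = bieleckiWeight ‖A‖ • Ψ`. -/
noncomputable def weightedPicard (A : ℝ → R) (hA : LocallyIntegrable A) (Ψ : ℝ →ᵇ R) : ℝ →ᵇ R :=
  have hw := continuous_bieleckiWeight (locallyIntegrable_norm hA)
  BoundedContinuousFunction.ofNormedAddCommGroup
    (fun t => (bieleckiWeight (‖A ·‖) t)⁻¹ •
      (1 + ∫ s in (0 : ℝ)..t, A s * (bieleckiWeight (‖A ·‖) s • Ψ s)))
    ((hw.inv₀ fun s => (bieleckiWeight_pos _ s).ne').smul (continuous_const.add
      (continuous_integral_of_locallyIntegrable (hA.mul_continuous (hw.smul Ψ.continuous)) 0)))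
    (‖(1 : R)‖ + ‖Ψ‖) fun t => by
      rw [norm_smul, norm_inv, Real.norm_of_nonneg (bieleckiWeight_pos _ t).le,
        inv_mul_le_iff₀ (bieleckiWeight_pos _ t)]
      refine (norm_add_le _ _).trans ?_
      have := norm_integral_mul_weight_smul_le hA Ψ t
      nlinarith [norm_nonneg (1 : R), norm_nonneg Ψ, one_le_bieleckiWeight (‖A ·‖) t]

lemma contractingWith_weightedPicard {A : ℝ → R} (hA : LocallyIntegrable A) :
    ContractingWith (1 / 2) (weightedPicard A hA) := by
  refine ⟨by rw [← NNReal.coe_lt_coe]; norm_num, LipschitzWith.of_dist_le_mul fun Ψ₁ Ψ₂ => ?_⟩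
  have hw := continuous_bieleckiWeight (locallyIntegrable_norm hA)
  rw [dist_eq_norm, dist_eq_norm]
  refine (BoundedContinuousFunction.norm_le (by positivity)).2 fun t => ?_
  have hi (Ψ : ℝ →ᵇ R) : IntervalIntegrable
      (fun s => A s * (bieleckiWeight (‖A ·‖) s • Ψ s)) volume 0 t :=
    intervalIntegrable_mul_continuous hA (hw.smul Ψ.continuous) 0 t
  have hsub : (weightedPicard A hA Ψ₁ - weightedPicard A hA Ψ₂) t =
      (bieleckiWeight (‖A ·‖) t)⁻¹ •
        ∫ s in (0 : ℝ)..t, A s * (bieleckiWeight (‖A ·‖) s • (Ψ₁ - Ψ₂) s) := by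
    simp only [BoundedContinuousFunction.sub_apply, smul_sub, mul_sub]
    rw [intervalIntegral.integral_sub (hi Ψ₁) (hi Ψ₂)]
    simp only [weightedPicard, BoundedContinuousFunction.coe_ofNormedAddCommGroup]
    rw [← smul_sub, add_sub_add_left_eq_sub]
  rw [hsub, norm_smul, norm_inv, Real.norm_of_nonneg (bieleckiWeight_pos _ t).le,
    inv_mul_le_iff₀ (bieleckiWeight_pos _ t)]
  refine (norm_integral_mul_weight_smul_le hA _ t).trans (le_of_eq ?_)
  push_cast
  ring

lemma exists_isPrincipal [CompleteSpace R] {A : ℝ → R} (hA : LocallyIntegrable A) :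
    ∃ Φ, IsPrincipal A Φ := by
  have hw := continuous_bieleckiWeight (locallyIntegrable_norm hA)
  obtain ⟨Ψ, hΨ⟩ : ∃ Ψ, weightedPicard A hA Ψ = Ψ :=
    ⟨_, (contractingWith_weightedPicard hA).fixedPoint_isFixedPt⟩
  refine ⟨fun t => bieleckiWeight (‖A ·‖) t • Ψ t, hw.smul Ψ.continuous, fun t => ?_⟩
  exact ((inv_smul_eq_iff₀ (bieleckiWeight_pos _ t).ne').1 (DFunLike.congr_fun hΨ t)).symm

lemma eq_of_eq_add_integral_mul {A Φ Ψ : ℝ → R} {c : R} (hA : LocallyIntegrable A)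
    (hΦ : Continuous Φ) (hΨ : Continuous Ψ) (hΦc : ∀ t, Φ t = c + ∫ s in (0 : ℝ)..t, A s * Φ s)
    (hΨc : ∀ t, Ψ t = c + ∫ s in (0 : ℝ)..t, A s * Ψ s) : Φ = Ψ := by
  funext t
  have hdiff : ∀ s, Φ s - Ψ s = ∫ r in (0 : ℝ)..s, A r * (Φ r - Ψ r) := fun s => by
    simp only [mul_sub]
    rw [intervalIntegral.integral_sub (intervalIntegrable_mul_continuous hA hΦ 0 s)
      (intervalIntegrable_mul_continuous hA hΨ 0 s), hΦc s, hΨc s]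
    abel
  have hGronwall := le_mul_bieleckiWeight_of_le_add_integral (ε := 0) (T := |t|)
    (u := fun s => ‖Φ s - Ψ s‖) (locallyIntegrable_norm hA) (fun _ => norm_nonneg _)
    (hΦ.sub hΨ).norm (fun _ => norm_nonneg _) (fun s _ => ?_) le_rfl
  · rw [mul_zero, zero_mul] at hGronwall
    exact sub_eq_zero.1 (norm_le_zero_iff.1 hGronwall)
  · rw [zero_add, hdiff s]
    exact intervalIntegral.norm_integral_le_abs_of_norm_le
      (Eventually.of_forall fun r => norm_mul_le _ _)
      (intervalIntegrable_mul_continuous (locallyIntegrable_norm hA) (hΦ.sub hΨ).norm 0 s)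

lemma IsPrincipal.mul_const_eq [CompleteSpace R] {A Φ : ℝ → R} (h : IsPrincipal A Φ)
    (hA : LocallyIntegrable A) (C : R) (t : ℝ) :
    Φ t * C = C + ∫ s in (0 : ℝ)..t, A s * (Φ s * C) := by
  simp only [← mul_assoc]
  rw [integral_mul_const_of_locallyIntegrable (hA.mul_continuous h.1), h.2 t, add_mul, one_mul]

lemma IsPrincipal.eq_add_integral {A Φ : ℝ → R} (h : IsPrincipal A Φ)
    (hA : LocallyIntegrable A) (s t : ℝ) : Φ t = Φ s + ∫ u in s..t, A u * Φ u := by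
  have hi := intervalIntegrable_mul_continuous hA h.1
  rw [h.2 t, h.2 s, add_assoc, intervalIntegral.integral_add_adjacent_intervals (hi _ _) (hi _ _)]

end Linear

section WeakConvergence

lemma forall_Icc_of_forall_short {P : ℝ → ℝ → Prop} {a b δ : ℝ} (hδ : 0 < δ)
    (htrans : ∀ ⦃x y z⦄, a ≤ x → x ≤ y → y ≤ z → z ≤ b → P x y → P y z → P x z)
    (hshort : ∀ ⦃x y⦄, a ≤ x → x ≤ y → y ≤ b → y - x ≤ δ → P x y) (hab : a ≤ b) : P a b := by
  have hmul : ∀ (k : ℕ) (y : ℝ), a ≤ y → y ≤ b → y - a ≤ (k + 1) * δ → P a y := by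
    intro k
    induction k with
    | zero => exact fun y hay hyb hk => hshort le_rfl hay hyb (by simpa using hk)
    | succ k ih =>
      intro y hay hyb hk
      push_cast at hk
      have hmid : y - max a (y - δ) ≤ δ := by linarith [le_max_right a (y - δ)]
      have hmid_le : max a (y - δ) ≤ y := max_le hay (by linarith)
      refine htrans le_rfl (le_max_left _ _) hmid_le hyb
        (ih _ (le_max_left _ _) (hmid_le.trans hyb) ?_) (hshort (le_max_left _ _) hmid_le hyb hmid)
      rw [sub_le_iff_le_add]
      exact max_le (by nlinarith [k.cast_nonneg (α := ℝ)]) (by linarith)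
  obtain ⟨k, hk⟩ := exists_nat_ge ((b - a) / δ)
  rw [div_le_iff₀ hδ] at hk
  exact hmul k b hab le_rfl (by linarith)

variable {ι E : Type*} [NormedAddCommGroup E] {F : Filter ι} {A : ι → ℝ → E}

/-- Equi-integrability of a family of curves on bounded intervals, up to discarding members of the
family along the filter `F`. -/
def EventuallyEquiintegrable (F : Filter ι) (A : ι → ℝ → E) : Prop :=
  ∀ r : ℝ, ∀ ε > 0, ∃ δ > 0, ∀ᶠ n in F, ∀ s ∈ Icc (-r) r, ∀ t ∈ Icc (-r) r, |t - s| ≤ δ →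
    |∫ u in s..t, ‖A n u‖| ≤ ε

lemma exists_forall_abs_integral_norm_le {B : ℝ → E} (hB : LocallyIntegrable B) (r : ℝ) {ε : ℝ}
    (hε : 0 < ε) : ∃ δ > 0, ∀ s ∈ Icc (-r) r, ∀ t ∈ Icc (-r) r, |t - s| ≤ δ →
      |∫ u in s..t, ‖B u‖| ≤ ε := by
  have hB' := locallyIntegrable_norm hB
  obtain ⟨δ, hδ, h⟩ := Metric.uniformContinuousOn_iff_le.1
    ((isCompact_Icc (a := -r) (b := r)).uniformContinuousOn_of_continuous
      (continuous_integral_of_locallyIntegrable hB' 0).continuousOn) ε hε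
  refine ⟨δ, hδ, fun s hs t ht hst => ?_⟩
  have := h t ht s hs hst
  rwa [Real.dist_eq, intervalIntegral.integral_interval_sub_left
    (intervalIntegrable_of_locallyIntegrable hB' 0 t)
    (intervalIntegrable_of_locallyIntegrable hB' 0 s)] at this

lemma EventuallyEquiintegrable.sub {B : ℝ → E} (h : EventuallyEquiintegrable F A)
    (hA : ∀ᶠ n in F, LocallyIntegrable (A n)) (hB : LocallyIntegrable B) :
    EventuallyEquiintegrable F fun n s => A n s - B s := by
  intro r ε hε
  obtain ⟨δ₁, hδ₁, h₁⟩ := h r (ε / 2) (half_pos hε)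
  obtain ⟨δ₂, hδ₂, h₂⟩ := exists_forall_abs_integral_norm_le hB r (half_pos hε)
  refine ⟨min δ₁ δ₂, lt_min hδ₁ hδ₂, ?_⟩
  filter_upwards [h₁, hA] with n hn hAn s hs t ht hst
  have hi := intervalIntegrable_of_locallyIntegrable (locallyIntegrable_norm hAn) s t
  have hi' := intervalIntegrable_of_locallyIntegrable (locallyIntegrable_norm hB) s t
  calc |∫ u in s..t, ‖A n u - B u‖|
      ≤ |∫ u in s..t, (‖A n u‖ + ‖B u‖)| :=
        intervalIntegral.norm_integral_le_abs_of_norm_le (f := fun u => ‖A n u - B u‖)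
          (Eventually.of_forall fun u => (norm_norm _).trans_le (norm_sub_le (A n u) (B u)))
          (hi.add hi')
    _ ≤ |∫ u in s..t, ‖A n u‖| + |∫ u in s..t, ‖B u‖| := by
        rw [intervalIntegral.integral_add hi hi']
        exact abs_add_le _ _
    _ ≤ ε := by
        linarith [hn s hs t ht (hst.trans (min_le_left _ _)),
          h₂ s hs t ht (hst.trans (min_le_right _ _))]

lemma EventuallyEquiintegrable.exists_abs_integral_norm_le (h : EventuallyEquiintegrable F A)
    (hA : ∀ᶠ n in F, LocallyIntegrable (A n)) (a b : ℝ) :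
    ∃ C : ℝ, ∀ᶠ n in F, |∫ u in a..b, ‖A n u‖| ≤ C := by
  wlog hab : a ≤ b generalizing a b
  · simpa only [intervalIntegral.integral_symm b a, abs_neg] using this b a (le_of_not_ge hab)
  set r := max (-a) b
  have hmem : ∀ x, a ≤ x → x ≤ b → x ∈ Icc (-r) r := fun x hax hxb =>
    ⟨(neg_le.1 (le_max_left (-a) b)).trans hax, hxb.trans (le_max_right _ _)⟩
  obtain ⟨δ, hδ, hshort⟩ := h r 1 one_pos
  refine forall_Icc_of_forall_short (P := fun x y => ∃ C : ℝ, ∀ᶠ n in F,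
    |∫ u in x..y, ‖A n u‖| ≤ C) hδ ?_ (fun x y hax hxy hyb hle => ⟨1, ?_⟩) hab
  · rintro x y z - - - - ⟨C, hC⟩ ⟨C', hC'⟩
    refine ⟨C + C', ?_⟩
    filter_upwards [hC, hC', hA] with n hn hn' hAn
    have hi := intervalIntegrable_of_locallyIntegrable (locallyIntegrable_norm hAn)
    rw [← intervalIntegral.integral_add_adjacent_intervals (hi x y) (hi y z)]
    exact (abs_add_le _ _).trans (add_le_add hn hn')
  · filter_upwards [hshort] with n hn
    exact hn x (hmem x hax (hxy.trans hyb)) y (hmem y (hax.trans hxy) hyb)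
      (by rwa [abs_of_nonneg (sub_nonneg.2 hxy)])

lemma EventuallyEquiintegrable.eventually_norm_integral_le [NormedSpace ℝ E]
    (h : EventuallyEquiintegrable F A) (hA : ∀ᶠ n in F, LocallyIntegrable (A n))
    (h0 : ∀ q : ℚ, Tendsto (fun n => ∫ s in (0 : ℝ)..q, A n s) F (𝓝 0)) (r : ℝ) {ε : ℝ}
    (hε : 0 < ε) : ∀ᶠ n in F, ∀ t, |t| ≤ r → ‖∫ s in (0 : ℝ)..t, A n s‖ ≤ ε := by
  obtain ⟨δ, hδ, hshort⟩ := h (r + 1) (ε / 2) (half_pos hε)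
  have hδ' : 0 < min δ 1 / 2 := by positivity
  choose q hq using fun x : ℝ => Rat.denseRange_cast (𝕜 := ℝ).exists_dist_lt x hδ'
  obtain ⟨s, -, hs⟩ := (isCompact_Icc (a := -r) (b := r)).elim_nhds_subcover
    (fun x => Metric.ball x (min δ 1 / 2)) fun x _ => Metric.ball_mem_nhds x hδ'
  have hnodes : ∀ᶠ n in F, ∀ x ∈ s, ‖∫ u in (0 : ℝ)..q x, A n u‖ ≤ ε / 2 :=
    (Filter.eventually_all_finset s).2 fun x _ =>
      (h0 (q x)).norm.eventually_le_const (by simpa using half_pos hε)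
  filter_upwards [hshort, hnodes, hA] with n hn hnode hAn t ht
  obtain ⟨x, hx, htx⟩ := mem_iUnion₂.1 (hs (abs_le.1 ht))
  have hdist : |t - q x| ≤ min δ 1 := by
    rw [← Real.dist_eq]
    linarith [dist_triangle t x (q x), Metric.mem_ball.1 htx, hq x]
  have hqx : |(q x : ℝ)| ≤ r + 1 := by
    linarith [abs_sub_abs_le_abs_sub (q x : ℝ) t, abs_sub_comm t (q x), min_le_right δ 1]
  have hi := intervalIntegrable_of_locallyIntegrable hAn
  have hlast := (intervalIntegral.norm_integral_le_abs_integral_norm (f := A n)).trans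
    (hn (q x) (abs_le.1 hqx) t (abs_le.1 (by linarith)) (hdist.trans (min_le_left _ _)))
  rw [← intervalIntegral.integral_add_adjacent_intervals (hi 0 (q x)) (hi (q x) t)]
  linarith [norm_add_le (∫ u in (0 : ℝ)..q x, A n u) (∫ u in (q x : ℝ)..t, A n u), hnode x hx]

variable {R : Type*} [NormedRing R]

lemma abs_integral_norm_mul_le {D Ψ : ℝ → R} (hD : LocallyIntegrable D) {a b M : ℝ} (hM0 : 0 ≤ M)
    (hM : ∀ s ∈ uIoc a b, ‖Ψ s‖ ≤ M) :
    |∫ s in a..b, ‖D s * Ψ s‖| ≤ M * |∫ s in a..b, ‖D s‖| := by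
  have hle : |∫ s in a..b, ‖D s * Ψ s‖| ≤ |∫ s in a..b, M * ‖D s‖| := by
    refine intervalIntegral.norm_integral_le_abs_of_norm_le (f := fun s => ‖D s * Ψ s‖) ?_
      ((intervalIntegrable_of_locallyIntegrable (locallyIntegrable_norm hD) a b).const_mul M)
    filter_upwards [ae_restrict_mem measurableSet_uIoc] with s hs
    rw [norm_norm, mul_comm M]
    exact (norm_mul_le _ _).trans (mul_le_mul_of_nonneg_left (hM s hs) (norm_nonneg _))
  rwa [intervalIntegral.integral_const_mul, abs_mul, abs_of_nonneg hM0] at hle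

lemma EventuallyEquiintegrable.mul_continuous {D : ι → ℝ → R} {Ψ : ℝ → R}
    (h : EventuallyEquiintegrable F D) (hD : ∀ᶠ n in F, LocallyIntegrable (D n))
    (hΨ : Continuous Ψ) : EventuallyEquiintegrable F fun n s => D n s * Ψ s := by
  intro r ε hε
  obtain ⟨C, hC⟩ := (isCompact_Icc (a := -r) (b := r)).exists_bound_of_continuousOn hΨ.continuousOn
  have hM : 0 < max C 1 := lt_max_of_lt_right one_pos
  obtain ⟨δ, hδ, hshort⟩ := h r (ε / max C 1) (by positivity)
  refine ⟨δ, hδ, ?_⟩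
  filter_upwards [hshort, hD] with n hn hDn s hs t ht hst
  have hmem : uIoc s t ⊆ Icc (-r) r := uIoc_subset_uIcc.trans (uIcc_subset_Icc hs ht)
  refine (abs_integral_norm_mul_le hDn hM.le fun u hu =>
    (hC u (hmem hu)).trans (le_max_left _ _)).trans ?_
  rw [← le_div_iff₀' hM]
  exact hn s hs t ht hst

variable [NormedAlgebra ℝ R]

lemma IsPrincipal.norm_sub_le {A B Φ Ψ : ℝ → R} (hΦ : IsPrincipal A Φ) (hΨ : IsPrincipal B Ψ)
    (hA : LocallyIntegrable A) (hB : LocallyIntegrable B) (t : ℝ) :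
    ‖Φ t - Ψ t‖ ≤ ‖∫ s in (0 : ℝ)..t, (A s - B s) * Ψ s‖ +
      |∫ s in (0 : ℝ)..t, ‖A s‖ * ‖Φ s - Ψ s‖| := by
  have heq : Φ t - Ψ t = (∫ s in (0 : ℝ)..t, (A s - B s) * Ψ s) +
      ∫ s in (0 : ℝ)..t, A s * (Φ s - Ψ s) := by
    have hAΨ := intervalIntegrable_mul_continuous hA hΨ.1 0 t
    simp only [sub_mul, mul_sub]
    rw [intervalIntegral.integral_sub hAΨ (intervalIntegrable_mul_continuous hB hΨ.1 0 t),
      intervalIntegral.integral_sub (intervalIntegrable_mul_continuous hA hΦ.1 0 t) hAΨ,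
      hΦ.2 t, hΨ.2 t]
    abel
  rw [heq]
  refine (norm_add_le _ _).trans (add_le_add_right ?_ _)
  exact intervalIntegral.norm_integral_le_abs_of_norm_le
    (Eventually.of_forall fun s => norm_mul_le _ _)
    (intervalIntegrable_mul_continuous (locallyIntegrable_norm hA) (hΦ.1.sub hΨ.1).norm 0 t)

variable [CompleteSpace R]

lemma norm_integral_mul_le_of_forall_norm_sub_le {D Ψ : ℝ → R} (hD : LocallyIntegrable D)
    (hΨ : Continuous Ψ) {a b η : ℝ} (hab : a ≤ b) (hη : 0 ≤ η)
    (hosc : ∀ s ∈ Ioc a b, ‖Ψ s - Ψ a‖ ≤ η) :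
    ‖∫ s in a..b, D s * Ψ s‖ ≤ η * (∫ s in a..b, ‖D s‖) + ‖(∫ s in a..b, D s) * Ψ a‖ := by
  have hsplit : ∫ s in a..b, D s * Ψ s =
      (∫ s in a..b, D s * (Ψ s - Ψ a)) + (∫ s in a..b, D s) * Ψ a := by
    have hosc_int := intervalIntegrable_mul_continuous hD
      (hΨ.sub (continuous_const (y := Ψ a))) a b
    have hconst_int := intervalIntegrable_mul_continuous hD (continuous_const (y := Ψ a)) a b
    rw [← integral_mul_const_of_locallyIntegrable hD]
    refine Eq.trans ?_ (intervalIntegral.integral_add hosc_int hconst_int)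
    simp only [← mul_add, sub_add_cancel]
  have hosc_le := abs_integral_norm_mul_le (Ψ := fun s => Ψ s - Ψ a) hD hη
    (by rwa [uIoc_of_le hab])
  rw [abs_of_nonneg (intervalIntegral.integral_nonneg hab fun s _ => norm_nonneg (D s))] at hosc_le
  rw [hsplit]
  exact (norm_add_le _ _).trans (add_le_add_left
    (intervalIntegral.norm_integral_le_abs_integral_norm.trans hosc_le) _)

lemma eventually_norm_integral_mul_le {D : ι → ℝ → R} {Ψ : ℝ → R}
    (hD : ∀ᶠ n in F, LocallyIntegrable (D n)) (hΨ : Continuous Ψ)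
    (h0 : ∀ a b, Tendsto (fun n => ∫ s in a..b, D n s) F (𝓝 0)) {a b η κ : ℝ} (hab : a ≤ b)
    (hη : 0 < η) (hκ : 0 < κ) :
    ∀ᶠ n in F, ‖∫ s in a..b, D n s * Ψ s‖ ≤ η * (∫ s in a..b, ‖D n s‖) + κ := by
  obtain ⟨δ, hδ, hosc⟩ := Metric.uniformContinuousOn_iff_le.1
    ((isCompact_Icc (a := a) (b := b)).uniformContinuousOn_of_continuous hΨ.continuousOn) η hη
  refine forall_Icc_of_forall_short (P := fun x y => ∀ κ > 0, ∀ᶠ n in F,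
    ‖∫ s in x..y, D n s * Ψ s‖ ≤ η * (∫ s in x..y, ‖D n s‖) + κ) hδ ?_ ?_ hab κ hκ
  · intro x y z _ _ _ _ hxy hyz κ hκ
    filter_upwards [hxy _ (half_pos hκ), hyz _ (half_pos hκ), hD] with n hnxy hnyz hDn
    have hi := intervalIntegrable_mul_continuous hDn hΨ
    have hi' := intervalIntegrable_of_locallyIntegrable (locallyIntegrable_norm hDn)
    rw [← intervalIntegral.integral_add_adjacent_intervals (hi x y) (hi y z),
      ← intervalIntegral.integral_add_adjacent_intervals (hi' x y) (hi' y z)]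
    linarith [norm_add_le (∫ s in x..y, D n s * Ψ s) (∫ s in y..z, D n s * Ψ s)]
  · intro x y hax hxy hyb hyx κ hκ
    have hmul := ((h0 x y).mul_const (Ψ x)).norm
    rw [zero_mul, norm_zero] at hmul
    filter_upwards [hmul.eventually_le_const hκ, hD] with n hn hDn
    refine (norm_integral_mul_le_of_forall_norm_sub_le hDn hΨ hxy hη.le fun s hs => ?_).trans
      (add_le_add_right hn _)
    rw [← dist_eq_norm]
    refine hosc s ⟨hax.trans hs.1.le, hs.2.trans hyb⟩ x ⟨hax, hxy.trans hyb⟩ ?_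
    rw [Real.dist_eq, abs_of_pos (sub_pos.2 hs.1)]
    linarith [hs.2]

lemma EventuallyEquiintegrable.tendsto_integral_mul {D : ι → ℝ → R} {Ψ : ℝ → R}
    (h : EventuallyEquiintegrable F D) (hD : ∀ᶠ n in F, LocallyIntegrable (D n))
    (hΨ : Continuous Ψ) (h0 : ∀ a b, Tendsto (fun n => ∫ s in a..b, D n s) F (𝓝 0)) (a b : ℝ) :
    Tendsto (fun n => ∫ s in a..b, D n s * Ψ s) F (𝓝 0) := by
  wlog hab : a ≤ b generalizing a b
  · simpa only [intervalIntegral.integral_symm b a, neg_zero] using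
      (this b a (le_of_not_ge hab)).neg
  obtain ⟨C, hC⟩ := h.exists_abs_integral_norm_le hD a b
  rw [NormedAddGroup.tendsto_nhds_zero]
  intro ε hε
  have hM : 0 < max C 1 := lt_max_of_lt_right one_pos
  filter_upwards [hC, eventually_norm_integral_mul_le hD hΨ h0 hab
    (η := ε / 4 / max C 1) (by positivity) (half_pos hε)] with n hCn hn
  have hsmall : ε / 4 / max C 1 * (∫ s in a..b, ‖D n s‖) ≤ ε / 4 := by
    calc ε / 4 / max C 1 * (∫ s in a..b, ‖D n s‖) ≤ ε / 4 / max C 1 * max C 1 := by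
          gcongr
          exact ((le_abs_self _).trans hCn).trans (le_max_left _ _)
      _ = ε / 4 := div_mul_cancel₀ _ hM.ne'
  linarith

lemma EventuallyEquiintegrable.eventually_norm_integral_mul_le {D : ι → ℝ → R} {Ψ : ℝ → R}
    (h : EventuallyEquiintegrable F D) (hD : ∀ᶠ n in F, LocallyIntegrable (D n))
    (hΨ : Continuous Ψ) (h0 : ∀ q : ℚ, Tendsto (fun n => ∫ s in (0 : ℝ)..q, D n s) F (𝓝 0))
    (r : ℝ) {ε : ℝ} (hε : 0 < ε) :
    ∀ᶠ n in F, ∀ t, |t| ≤ r → ‖∫ s in (0 : ℝ)..t, D n s * Ψ s‖ ≤ ε := by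
  have hreal : ∀ t, Tendsto (fun n => ∫ s in (0 : ℝ)..t, D n s) F (𝓝 0) := fun t =>
    NormedAddGroup.tendsto_nhds_zero.2 fun κ hκ =>
      (h.eventually_norm_integral_le hD h0 |t| (half_pos hκ)).mono fun n hn =>
        (hn t le_rfl).trans_lt (half_lt_self hκ)
  have hreal' : ∀ a b, Tendsto (fun n => ∫ s in a..b, D n s) F (𝓝 0) := fun a b => by
    have hsub := (hreal b).sub (hreal a)
    rw [sub_zero] at hsub
    refine hsub.congr' (hD.mono fun n hDn => ?_)
    exact intervalIntegral.integral_interval_sub_left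
      (intervalIntegrable_of_locallyIntegrable hDn 0 b)
      (intervalIntegrable_of_locallyIntegrable hDn 0 a)
  exact (h.mul_continuous hD hΨ).eventually_norm_integral_le
    (hD.mono fun n hDn => hDn.mul_continuous hΨ)
    (fun q => h.tendsto_integral_mul hD hΨ hreal' 0 q) r hε

lemma tendsto_isPrincipal {A : ι → ℝ → R} {B : ℝ → R} {Φ : ι → ℝ → R} {Ψ : ℝ → R}
    (hA : ∀ᶠ n in F, LocallyIntegrable (A n)) (hB : LocallyIntegrable B)
    (hΦ : ∀ᶠ n in F, IsPrincipal (A n) (Φ n)) (hΨ : IsPrincipal B Ψ)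
    (hAB : ∀ q : ℚ, Tendsto (fun n => ∫ s in (0 : ℝ)..q, A n s) F (𝓝 (∫ s in (0 : ℝ)..q, B s)))
    (h : EventuallyEquiintegrable F A) (t : ℝ) :
    Tendsto (fun n => Φ n t) F (𝓝 (Ψ t)) := by
  have hsub : ∀ q : ℚ, Tendsto (fun n => ∫ s in (0 : ℝ)..q, (A n s - B s)) F (𝓝 0) := fun q => by
    refine (tendsto_sub_nhds_zero_iff.2 (hAB q)).congr' (hA.mono fun n hAn => ?_)
    exact (intervalIntegral.integral_sub (intervalIntegrable_of_locallyIntegrable hAn 0 q)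
      (intervalIntegrable_of_locallyIntegrable hB 0 q)).symm
  obtain ⟨C, hC⟩ := h.exists_abs_integral_norm_le hA 0 t
  rw [tendsto_iff_norm_sub_tendsto_zero, NormedAddGroup.tendsto_nhds_zero]
  intro ε hε
  filter_upwards [hA, hΦ, hC, (h.sub hA hB).eventually_norm_integral_mul_le
    (hA.mono fun n hAn => hAn.sub hB) hΨ.1 hsub |t| (ε := ε / (4 * Real.exp (2 * C)))
    (by positivity)] with n hAn hΦn hCn hsmall
  have hGronwall := le_mul_bieleckiWeight_of_le_add_integral (u := fun s => ‖Φ n s - Ψ s‖)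
    (locallyIntegrable_norm hAn) (fun _ => norm_nonneg _) (hΦn.1.sub hΨ.1).norm
    (fun _ => norm_nonneg _) (fun s hs => (hΦn.norm_sub_le hΨ hAn hB s).trans
      (add_le_add_left (hsmall s hs) _)) le_rfl
  rw [norm_norm]
  calc ‖Φ n t - Ψ t‖
      ≤ 2 * (ε / (4 * Real.exp (2 * C))) * bieleckiWeight (‖A n ·‖) t := hGronwall
    _ ≤ 2 * (ε / (4 * Real.exp (2 * C))) * Real.exp (2 * C) := by
        unfold bieleckiWeight
        gcongr
    _ = ε / 2 := by field_simp; norm_num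
    _ < ε := half_lt_self hε

end WeakConvergence

section Modulus

/-- A nonnegative monotone modulus on `[0, ∞)` that is arbitrarily small at some positive
argument. -/
structure IsModulus (θ : ℝ → ℝ) : Prop where
  nonneg : ∀ s, 0 ≤ s → 0 ≤ θ s
  mono : ∀ s t, 0 ≤ s → s ≤ t → θ s ≤ θ t
  small : ∀ ε > 0, ∃ δ > 0, θ δ ≤ ε

variable {θ : ℝ → ℝ}

lemma IsModulus.exists_forall_abs_le (hθ : IsModulus θ) {ε : ℝ} (hε : 0 < ε) :
    ∃ δ > 0, ∀ s t : ℝ, |t - s| ≤ δ → θ |t - s| ≤ ε :=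
  let ⟨δ, hδ, hθδ⟩ := hθ.small ε hε
  ⟨δ, hδ, fun _ _ hst => (hθ.mono _ _ (abs_nonneg _) hst).trans hθδ⟩

lemma IsModulus.continuous {E : Type*} [SeminormedAddCommGroup E] (hθ : IsModulus θ) {x : ℝ → E}
    (hx : ∀ s t, ‖x t - x s‖ ≤ θ |t - s|) : Continuous x := by
  refine Metric.continuous_iff.2 fun s ε hε => ?_
  obtain ⟨δ, hδ, h⟩ := hθ.exists_forall_abs_le (half_pos hε)
  refine ⟨δ, hδ, fun t hts => ?_⟩
  rw [dist_eq_norm]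
  linarith [hx s t, h s t (by rw [← Real.dist_eq]; exact hts.le)]

end Modulus

section LimitDensity

lemma locallyIntegrable_deriv_of_monotone {M : ℝ → ℝ} (hM : Monotone M) :
    LocallyIntegrable (deriv M) := by
  refine locallyIntegrable_iff.2 fun k hk => ?_
  obtain ⟨r, hr⟩ := hk.isBounded.subset_closedBall 0
  rw [Real.closedBall_eq_Icc] at hr
  rcases le_or_gt (0 - r) (0 + r) with h | h
  · exact ((intervalIntegrable_iff_integrableOn_Icc_of_le h).1
      (hM.monotoneOn _).intervalIntegrable_deriv).mono_set hr
  · rw [Icc_eq_empty h.not_ge] at hr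
    rw [subset_empty_iff.1 hr]
    exact integrableOn_empty

lemma ae_norm_le_deriv_of_norm_integral_le {E : Type*} [NormedAddCommGroup E] [NormedSpace ℝ E]
    [CompleteSpace E] {B : ℝ → E} {M : ℝ → ℝ} (hB : LocallyIntegrable B) (hM : Monotone M)
    (h : ∀ a b, ‖∫ u in a..b, B u‖ ≤ |M b - M a|) : ∀ᵐ t, ‖B t‖ ≤ deriv M t := by
  filter_upwards [_root_.LocallyIntegrable.ae_hasDerivAt_integral hB,
    hM.ae_differentiableAt] with t hBt hMt
  refine (le_of_tendsto_of_tendsto (hasDerivAt_iff_tendsto_slope.1 (hBt t)).norm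
    (hasDerivAt_iff_tendsto_slope.1 hMt.hasDerivAt).norm (Eventually.of_forall fun s => ?_)).trans
    (abs_of_nonneg hM.deriv_nonneg).le
  simp only [slope_def_module, norm_smul, intervalIntegral.integral_same, sub_zero,
    Real.norm_eq_abs]
  gcongr
  exact h t s

variable {ι : Type*} {m : ι → ℝ → ℝ} {θ : ℝ → ℝ}

lemma exists_tendsto_integral_ultrafilter (U : Ultrafilter ι)
    (hm : ∀ i, LocallyIntegrable (m i)) (h0 : ∀ i t, 0 ≤ m i t)
    (hle : ∀ i a b, a ≤ b → ∫ u in a..b, m i u ≤ θ (b - a)) :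
    ∃ M : ℝ → ℝ, ∀ a b, Tendsto (fun i => ∫ u in a..b, m i u) U (𝓝 (M b - M a)) := by
  have hlim : ∀ t, ∃ L, Tendsto (fun i => ∫ u in (0 : ℝ)..t, m i u) U (𝓝 L) := by
    intro t
    have hmem : ∀ i, ∫ u in (0 : ℝ)..t, m i u ∈ Icc (-θ |t|) (θ |t|) := fun i => abs_le.1 <| by
      rcases le_total 0 t with ht | ht
      · rw [abs_of_nonneg (intervalIntegral.integral_nonneg ht fun u _ => h0 i u), abs_of_nonneg ht]
        simpa using hle i 0 t ht
      · rw [intervalIntegral.integral_symm, abs_neg,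
          abs_of_nonneg (intervalIntegral.integral_nonneg ht fun u _ => h0 i u), abs_of_nonpos ht]
        simpa using hle i t 0 ht
    obtain ⟨L, -, hL⟩ := isCompact_Icc.ultrafilter_le_nhds
      (U.map fun i => ∫ u in (0 : ℝ)..t, m i u) (tendsto_principal.2 (Eventually.of_forall hmem))
    exact ⟨L, hL⟩
  choose M hM using hlim
  refine ⟨M, fun a b => ((hM b).sub (hM a)).congr fun i => ?_⟩
  exact intervalIntegral.integral_interval_sub_left
    (intervalIntegrable_of_locallyIntegrable (hm i) 0 b)
    (intervalIntegrable_of_locallyIntegrable (hm i) 0 a)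

lemma norm_integral_le_abs_sub_of_forall_rat {E : Type*} [NormedAddCommGroup E] [NormedSpace ℝ E]
    {B : ℝ → E} {M : ℝ → ℝ} (hB : LocallyIntegrable B) (hM : Continuous M)
    (h : ∀ p q : ℚ, p ≤ q → ‖∫ u in (p : ℝ)..q, B u‖ ≤ |M q - M p|) (a b : ℝ) :
    ‖∫ u in a..b, B u‖ ≤ |M b - M a| := by
  have hcont : Continuous fun p : ℝ × ℝ => ∫ u in p.1..p.2, B u := by
    have hB0 := continuous_integral_of_locallyIntegrable hB 0
    refine ((hB0.comp continuous_snd).sub (hB0.comp continuous_fst)).congr fun p => ?_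
    exact intervalIntegral.integral_interval_sub_left
      (intervalIntegrable_of_locallyIntegrable hB 0 _)
      (intervalIntegrable_of_locallyIntegrable hB 0 _)
  refine Rat.denseRange_cast.induction_on₂
    (p := fun a b : ℝ => ‖∫ u in a..b, B u‖ ≤ |M b - M a|)
    (isClosed_le hcont.norm (by fun_prop)) (fun p q => ?_) a b
  rcases le_total p q with hpq | hpq
  · exact h p q hpq
  · rw [intervalIntegral.integral_symm, norm_neg, abs_sub_comm]
    exact h q p hpq

lemma IsModulus.continuous_of_monotone (hθ : IsModulus θ) {M : ℝ → ℝ} (hM : Monotone M)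
    (hle : ∀ a b, a ≤ b → M b - M a ≤ θ (b - a)) : Continuous M :=
  hθ.continuous fun s t => by
    rcases le_total s t with hst | hst
    · rw [Real.norm_eq_abs, abs_of_nonneg (sub_nonneg.2 (hM hst)),
        abs_of_nonneg (sub_nonneg.2 hst)]
      exact hle s t hst
    · rw [norm_sub_rev, Real.norm_eq_abs, abs_of_nonneg (sub_nonneg.2 (hM hst)),
        abs_of_nonpos (sub_nonpos.2 hst), neg_sub]
      exact hle t s hst

/-- The bounds `m i` need not converge, but their primitives do, to a monotone function whose
derivative bounds all weak limits. -/
lemma exists_bound_of_tendsto_integral (U : Ultrafilter ι) (hθ : IsModulus θ)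
    (hm : ∀ i, LocallyIntegrable (m i)) (h0 : ∀ i t, 0 ≤ m i t)
    (hle : ∀ i a b, a ≤ b → ∫ u in a..b, m i u ≤ θ (b - a))
    (E : Type*) [NormedAddCommGroup E] [NormedSpace ℝ E] [CompleteSpace E] :
    ∃ μ : ℝ → ℝ, LocallyIntegrable μ ∧ (∀ a b, a ≤ b → ∫ u in a..b, μ u ≤ θ (b - a)) ∧
      ∀ (A : ι → ℝ → E) (B : ℝ → E), LocallyIntegrable B →
        (∀ i, ∀ᵐ u, ‖A i u‖ ≤ m i u) →
        (∀ p q : ℚ, p ≤ q →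
          Tendsto (fun i => ∫ u in (p : ℝ)..q, A i u) U (𝓝 (∫ u in (p : ℝ)..q, B u))) →
        ∀ᵐ u, ‖B u‖ ≤ μ u := by
  obtain ⟨M, hM⟩ := exists_tendsto_integral_ultrafilter U hm h0 hle
  have hMmono : Monotone M := fun a b hab => sub_nonneg.1 <|
    ge_of_tendsto' (hM a b) fun i => intervalIntegral.integral_nonneg hab fun u _ => h0 i u
  have hMle : ∀ a b, a ≤ b → M b - M a ≤ θ (b - a) := fun a b hab =>
    le_of_tendsto' (hM a b) fun i => hle i a b hab
  refine ⟨deriv M, locallyIntegrable_deriv_of_monotone hMmono, fun a b hab => ?_,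
    fun A B hB hA hAB => ae_norm_le_deriv_of_norm_integral_le hB hMmono
      (norm_integral_le_abs_sub_of_forall_rat hB (hθ.continuous_of_monotone hMmono hMle)
        fun p q hpq => ?_)⟩
  · have hmem := (hMmono.monotoneOn (uIcc a b)).intervalIntegral_deriv_mem_uIcc
    rw [uIcc_of_le (sub_nonneg.2 (hMmono hab))] at hmem
    exact hmem.2.trans (hMle a b hab)
  · refine (le_of_tendsto_of_tendsto' (hAB p q hpq).norm (hM p q) fun i => ?_).trans
      (le_abs_self _)
    exact intervalIntegral.norm_integral_le_of_norm_le (Rat.cast_le.2 hpq)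
      ((hA i).mono fun u hu _ => hu) (intervalIntegrable_of_locallyIntegrable (hm i) _ _)

end LimitDensity

section Bounds

variable {N : ℕ} {V : Type*} [NormedAddCommGroup V] [NormedSpace ℝ V]
  [MeasurableSpace V] [BorelSpace V] [SecondCountableTopology V] {f : Car N V}

lemma Car.sub_apply (f g : Car N V) (p : ℝ × Euc N) : (f - g) p = f p - g p := rfl

lemma Car.shift_apply (τ : ℝ) (f : Car N V) (p : ℝ × Euc N) :
    f.shift τ p = f (p.1 + τ, p.2) := rfl

lemma Car.shift_shift (f : Car N V) (s t : ℝ) : (f.shift s).shift t = f.shift (t + s) :=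
  Subtype.ext <| funext fun p => congrArg (fun u => f (u, p.2)) (add_assoc p.1 t s)

lemma Car.shift_zero (f : Car N V) : f.shift 0 = f :=
  Subtype.ext <| funext fun p => congrArg (fun u => f (u, p.2)) (add_zero p.1)

lemma Car.locallyIntegrable_comp (f : Car N V) {x : ℝ → Euc N} (hx : Continuous x) :
    LocallyIntegrable fun t => f (t, x t) := by
  refine locallyIntegrable_iff.2 fun k hk => ?_
  obtain ⟨m, hm, hfm⟩ := f.2.2 (x '' k) (hk.image hx)
  refine Integrable.mono' (hm.integrableOn_isCompact hk)
    (f.2.1.comp (measurable_id.prodMk hx.measurable)).aestronglyMeasurable ?_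
  filter_upwards [ae_restrict_of_ae hfm, ae_restrict_mem hk.measurableSet] with t hft ht
  exact hft _ (mem_image_of_mem x ht)

lemma IsSC.shift (hf : IsSC f) (τ : ℝ) : IsSC (f.shift τ) :=
  (measurePreserving_add_right (volume : Measure ℝ) τ).quasiMeasurePreserving.ae hf

lemma IsLC.isSC (hf : IsLC f) : IsSC f := by
  have continuousOn_ball (j : ℕ) :
      ∀ᵐ t : ℝ, ContinuousOn (fun x => f (t, x)) (Metric.closedBall 0 j) := by
    obtain ⟨l, -, hl⟩ := hf _ (isCompact_closedBall (0 : Euc N) (j : ℝ))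
    filter_upwards [hl] with t ht
    refine (LipschitzOnWith.of_dist_le_mul (K := (l t).toNNReal) fun x hx y hy => ?_).continuousOn
    rw [dist_eq_norm, dist_eq_norm]
    exact (ht x hx y hy).trans (by gcongr; exact Real.le_coe_toNNReal _)
  filter_upwards [ae_all_iff.2 continuousOn_ball] with t ht
  refine continuous_iff_continuousAt.2 fun x => ?_
  obtain ⟨j, hj⟩ := exists_nat_gt ‖x‖
  exact (ht j).continuousAt (Metric.closedBall_mem_nhds_of_mem (by simpa using hj))

lemma optMBound_nonneg (f : Car N V) (j : ℕ) (t : ℝ) : 0 ≤ optMBound f j t :=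
  Real.iSup_nonneg fun _ => norm_nonneg _

lemma IsMBound.ae_optMBound_le {j : ℕ} {m : ℝ → ℝ}
    (hm : IsMBound f (Metric.closedBall 0 j) m) : ∀ᵐ t, optMBound f j t ≤ m t := by
  have : Nonempty (Metric.closedBall (0 : Euc N) j) :=
    ⟨0, Metric.mem_closedBall_self j.cast_nonneg⟩
  filter_upwards [hm.2] with t ht
  exact ciSup_le fun x => ht x x.2

lemma IsSC.aemeasurable_optMBound (hf : IsSC f) (j : ℕ) : AEMeasurable (optMBound f j) := by
  obtain ⟨D, hDc, hD⟩ := TopologicalSpace.exists_countable_dense (Metric.closedBall (0 : Euc N) j)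
  have : Countable D := hDc.to_subtype
  refine ⟨fun t => ⨆ x : D, ‖f (t, ((x : Metric.closedBall (0 : Euc N) j) : Euc N))‖,
    Measurable.iSup fun x => (f.2.1.comp (measurable_id.prodMk measurable_const)).norm, ?_⟩
  filter_upwards [hf] with t ht
  exact (hD.ciSup' (f := fun x : Metric.closedBall (0 : Euc N) j => ‖f (t, (x : Euc N))‖)
    (ht.comp continuous_subtype_val).norm).symm

lemma IsSC.isMBound_optMBound (hf : IsSC f) (j : ℕ) :
    IsMBound f (Metric.closedBall 0 j) (optMBound f j) := by
  obtain ⟨m, hm⟩ := f.2.2 (Metric.closedBall 0 j) (isCompact_closedBall _ _)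
  refine ⟨hm.1.mono (hf.aemeasurable_optMBound j).aestronglyMeasurable ?_, ?_⟩
  · filter_upwards [hm.ae_optMBound_le] with t ht
    rw [Real.norm_of_nonneg (optMBound_nonneg f j t)]
    exact ht.trans (le_abs_self _)
  · filter_upwards [hm.2] with t ht x hx
    exact le_ciSup (f := fun x : Metric.closedBall (0 : Euc N) j => ‖f (t, (x : Euc N))‖)
      ⟨m t, forall_mem_range.2 fun y => ht y y.2⟩ ⟨x, hx⟩

lemma integral_optMBound_shift (f : Car N V) (τ : ℝ) (j : ℕ) (a b : ℝ) :
    ∫ u in a..b, optMBound (f.shift τ) j u = ∫ u in a + τ..b + τ, optMBound f j u :=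
  intervalIntegral.integral_comp_add_right (optMBound f j) τ

lemma HasEquicontinuousMBounds.exists_forall_integral_optMBound_le
    (hf : HasEquicontinuousMBounds f) (hS : IsSC f) (j : ℕ) {ε : ℝ} (hε : 0 < ε) :
    ∃ δ > 0, ∀ s t : ℝ, s ≤ t → t - s ≤ δ → ∫ u in s..t, optMBound f j u ≤ ε := by
  obtain ⟨S, -, hbound, hequi⟩ := hf j
  obtain ⟨δ, hδ, hSδ⟩ := hequi 1 one_pos ε hε
  refine ⟨min (δ / 2) 1, by positivity, fun s t hst hts => ?_⟩
  obtain ⟨hts2, hts1⟩ := le_min_iff.1 hts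
  obtain ⟨m, hmS, hm⟩ := hbound s
  calc ∫ u in s..t, optMBound f j u
      = ∫ u in (0 : ℝ)..t - s, optMBound (f.shift s) j u := by
        rw [integral_optMBound_shift, zero_add, sub_add_cancel]
    _ ≤ ∫ u in (0 : ℝ)..t - s, m u :=
        intervalIntegral.integral_mono_ae (sub_nonneg.2 hst)
          (intervalIntegrable_of_locallyIntegrable ((hS.shift s).isMBound_optMBound j).1 _ _)
          (intervalIntegrable_of_locallyIntegrable hm.1 _ _) hm.ae_optMBound_le
    _ ≤ ε := (hSδ 0 (t - s) (by norm_num) (by linarith) hts1 (by linarith) m hmS).le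

lemma HasEquicontinuousMBounds.bddAbove_integral_optMBound
    (hf : HasEquicontinuousMBounds f) (hS : IsSC f) (j : ℕ) {s : ℝ} (hs : 0 ≤ s) :
    BddAbove (range fun t : ℝ => ∫ u in t..t + s, optMBound f j u) := by
  obtain ⟨δ, hδ, hshort⟩ := hf.exists_forall_integral_optMBound_le hS j one_pos
  have hint := intervalIntegrable_of_locallyIntegrable (hS.isMBound_optMBound j).1
  obtain ⟨C, hC⟩ : ∃ C, ∀ t, ∫ u in t + 0..t + s, optMBound f j u ≤ C := by
    refine forall_Icc_of_forall_short (a := 0) (b := s) hδ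
      (P := fun x y => ∃ C, ∀ t, ∫ u in t + x..t + y, optMBound f j u ≤ C)
      (fun x y z _ _ _ _ ⟨C, hC⟩ ⟨D, hD⟩ => ⟨C + D, fun t => ?_⟩)
      (fun x y _ hxy _ hd => ⟨1, fun t => hshort _ _ (by linarith) (by linarith)⟩) hs
    rw [← intervalIntegral.integral_add_adjacent_intervals (hint _ _) (hint (t + y) _)]
    exact add_le_add (hC t) (hD t)
  exact ⟨C, forall_mem_range.2 fun t => by simpa only [add_zero] using hC t⟩

lemma HasEquicontinuousMBounds.integral_optMBound_shift_le_theta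
    (hf : HasEquicontinuousMBounds f) (hS : IsSC f) (j : ℕ) (τ : ℝ) {a b : ℝ} (hab : a ≤ b) :
    ∫ u in a..b, optMBound (f.shift τ) j u ≤ theta f j (b - a) := by
  have h := le_ciSup (hf.bddAbove_integral_optMBound hS j (sub_nonneg.2 hab)) (a + τ)
  rw [show a + τ + (b - a) = b + τ by ring] at h
  exact (integral_optMBound_shift f τ j a b).trans_le h

lemma HasEquicontinuousMBounds.isModulus_theta
    (hf : HasEquicontinuousMBounds f) (hS : IsSC f) (j : ℕ) : IsModulus (theta f j) where
  nonneg s hs := Real.iSup_nonneg fun t =>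
    intervalIntegral.integral_nonneg (by linarith) fun u _ => optMBound_nonneg f j u
  mono s t hs hst := ciSup_mono (hf.bddAbove_integral_optMBound hS j (hs.trans hst)) fun u =>
    intervalIntegral.integral_mono_interval le_rfl (by linarith) (by linarith)
      (ae_of_all _ (optMBound_nonneg f j))
      (intervalIntegrable_of_locallyIntegrable (hS.isMBound_optMBound j).1 _ _)
  small ε hε :=
    let ⟨δ, hδ, h⟩ := hf.exists_forall_integral_optMBound_le hS j hε
    ⟨δ, hδ, ciSup_le fun t => h t (t + δ) (by linarith) (by linarith)⟩

end Bounds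

section Topology

variable {N : ℕ} {V : Type*} [NormedAddCommGroup V] [NormedSpace ℝ V]
  [MeasurableSpace V] [BorelSpace V] [SecondCountableTopology V]
  {mode : Mode} {Θ : ℕ → ℝ → ℝ} {j : ℕ} {x : ℝ → Euc N}

lemma tendsto_car_iff {ι : Type*} {l : Filter ι} {u : ι → Car N V} {g : Car N V} :
    Tendsto u l (@nhds _ (carTopology mode Θ N V) g) ↔
      ∀ i, ∀ ε > 0, ∀ᶠ n in l, seminorms mode N V Θ i (u n - g) < ε := by
  let _ := carTopology mode Θ N V
  have h : WithSeminorms (seminorms mode N V Θ) := ⟨rfl⟩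
  exact h.tendsto_nhds u g

lemma bddAbove_setIntegral_norm (f : Car N V) (Θ : ℕ → ℝ → ℝ) (q : ℚ × ℚ) (j : ℕ) :
    BddAbove (range fun x : modSet N Θ q j =>
      ∫ t in Icc (q.1 : ℝ) q.2, ‖f (t, (x : ℝ → Euc N) t)‖) :=
  let ⟨C, hC⟩ := f.exists_bound Θ q j
  ⟨C, forall_mem_range.2 fun x => (hC x x.2).2⟩

lemma setIntegral_norm_le_seminorms (f : Car N V) {q : ℚ × ℚ} (hx : x ∈ modSet N Θ q j) :
    ∫ t in Icc (q.1 : ℝ) q.2, ‖f (t, x t)‖ ≤ seminorms .strong N V Θ (q, j) f :=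
  le_ciSup (bddAbove_setIntegral_norm f Θ q j) ⟨x, hx⟩

lemma norm_setIntegral_le_seminorms (mode : Mode) (f : Car N V) {q : ℚ × ℚ}
    (hx : x ∈ modSet N Θ q j) :
    ‖∫ t in Icc (q.1 : ℝ) q.2, f (t, x t)‖ ≤ seminorms mode N V Θ (q, j) f := by
  cases mode with
  | strong => exact (norm_integral_le_integral_norm _).trans (setIntegral_norm_le_seminorms f hx)
  | weak =>
    exact le_ciSup (f := fun x : modSet N Θ q j =>
      ‖∫ t in Icc (q.1 : ℝ) q.2, f (t, (x : ℝ → Euc N) t)‖)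
      ((bddAbove_setIntegral_norm f Θ q j).range_mono _
        fun x => norm_integral_le_integral_norm _) ⟨x, hx⟩

/-- The global counterpart of `modSet`: curves in the ball `B_j` with modulus of continuity `Θ j`
on the whole line. They belong to all the sets `𝒦_j^I` at once. -/
def modCurves (N : ℕ) (Θ : ℕ → ℝ → ℝ) (j : ℕ) : Set (ℝ → Euc N) :=
  {x | Continuous x ∧ (∀ t, x t ∈ Metric.closedBall 0 j) ∧ ∀ s t, ‖x t - x s‖ ≤ Θ j |t - s|}

lemma modCurves_subset_modSet (q : ℚ × ℚ) : modCurves N Θ j ⊆ modSet N Θ q j :=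
  fun _ hx => ⟨hx.1.continuousOn, fun t _ => hx.2.1 t, fun s _ t _ => hx.2.2 s t⟩

lemma const_mem_modCurves (hΘ : IsModulus (Θ j)) {c : Euc N} (hc : c ∈ Metric.closedBall 0 j) :
    (fun _ => c) ∈ modCurves N Θ j :=
  ⟨continuous_const, fun _ => hc, fun s t => by
    simpa only [sub_self, norm_zero] using hΘ.nonneg _ (abs_nonneg (t - s))⟩

lemma IccExtend_mem_modCurves (hΘ : IsModulus (Θ j)) {a b : ℝ} (hab : a ≤ b)
    (hx : Continuous x) (hxj : ∀ t ∈ Icc a b, x t ∈ Metric.closedBall 0 j)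
    (hmod : ∀ s ∈ Icc a b, ∀ t ∈ Icc a b, ‖x t - x s‖ ≤ Θ j |t - s|) :
    IccExtend hab (fun t : Icc a b => x t) ∈ modCurves N Θ j :=
  ⟨(hx.comp continuous_subtype_val).Icc_extend', fun t => hxj _ (projIcc a b hab t).2,
    fun s t => (hmod _ (projIcc a b hab s).2 _ (projIcc a b hab t).2).trans
      (hΘ.mono _ _ (abs_nonneg _) (abs_projIcc_sub_projIcc hab))⟩

lemma tendsto_integral_sub_of_tendsto_car {ι : Type*} {l : Filter ι} {u : ι → Car N V} {g : Car N V}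
    (h : Tendsto u l (@nhds _ (carTopology mode Θ N V) g)) (j : ℕ) (p q : ℚ) :
    Tendsto (fun n : ι × (ℝ → Euc N) => ∫ t in (p : ℝ)..q, (u n.1 - g) (t, n.2 t))
      (l ×ˢ 𝓟 (modCurves N Θ j)) (𝓝 0) := by
  wlog hpq : p ≤ q generalizing p q
  · simpa only [neg_zero, ← intervalIntegral.integral_symm] using
      (this q p (le_of_not_ge hpq)).neg
  refine Metric.tendsto_nhds.2 fun ε hε => eventually_prod_principal_iff.2 ?_
  filter_upwards [tendsto_car_iff.1 h ((p, q), j) ε hε] with n hn x hx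
  rw [dist_zero_right, intervalIntegral.integral_of_le (Rat.cast_le.2 hpq),
    ← integral_Icc_eq_integral_Ioc]
  exact (norm_setIntegral_le_seminorms mode _ (modCurves_subset_modSet (p, q) hx)).trans_lt hn

lemma tendsto_integral_of_tendsto_car {ι : Type*} {l : Filter ι} {u : ι → Car N V} {g : Car N V}
    (h : Tendsto u l (@nhds _ (carTopology mode Θ N V) g)) (hx : x ∈ modCurves N Θ j) (p q : ℚ) :
    Tendsto (fun n => ∫ t in (p : ℝ)..q, u n (t, x t)) l (𝓝 (∫ t in (p : ℝ)..q, g (t, x t))) := by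
  have hpair : Tendsto (fun n => (n, x)) l (l ×ˢ 𝓟 (modCurves N Θ j)) :=
    tendsto_id.prodMk (tendsto_principal.2 (Eventually.of_forall fun _ => hx))
  refine tendsto_sub_nhds_zero_iff.1 <|
    ((tendsto_integral_sub_of_tendsto_car h j p q).comp hpair).congr fun n => ?_
  exact intervalIntegral.integral_sub
    (intervalIntegrable_of_locallyIntegrable ((u n).locallyIntegrable_comp hx.1) _ _)
    (intervalIntegrable_of_locallyIntegrable (g.locallyIntegrable_comp hx.1) _ _)

lemma tendsto_integral_norm_sub_of_tendsto_car {ι : Type*} {l : Filter ι} {u : ι → Car N V}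
    {g : Car N V} (h : Tendsto u l (@nhds _ (carTopology .strong Θ N V) g)) (j : ℕ) (q : ℚ × ℚ) :
    Tendsto (fun n : ι × (ℝ → Euc N) => ∫ t in Icc (q.1 : ℝ) q.2, ‖(u n.1 - g) (t, n.2 t)‖)
      (l ×ˢ 𝓟 (modCurves N Θ j)) (𝓝 0) := by
  refine Metric.tendsto_nhds.2 fun ε hε => eventually_prod_principal_iff.2 ?_
  filter_upwards [tendsto_car_iff.1 h (q, j) ε hε] with n hn x hx
  rw [dist_zero_right, Real.norm_of_nonneg (integral_nonneg fun _ => norm_nonneg _)]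
  exact (setIntegral_norm_le_seminorms _ (modCurves_subset_modSet q hx)).trans_lt hn

variable [CompleteSpace V] {f g : Car N V} {U : Ultrafilter ℝ}

lemma HasEquicontinuousMBounds.exists_bound_of_tendsto_shift
    (hf : HasEquicontinuousMBounds f) (hS : IsSC f)
    (h : Tendsto f.shift U (@nhds _ (carTopology mode Θ N V) g)) (j : ℕ) :
    ∃ m : ℝ → ℝ, LocallyIntegrable m ∧ (∀ a b, a ≤ b → ∫ u in a..b, m u ≤ theta f j (b - a)) ∧
      ∀ x ∈ modCurves N Θ j, ∀ᵐ u, ‖g (u, x u)‖ ≤ m u := by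
  obtain ⟨m, hm, hmθ, hbound⟩ := exists_bound_of_tendsto_integral U (hf.isModulus_theta hS j)
    (fun τ => ((hS.shift τ).isMBound_optMBound j).1) (fun τ => optMBound_nonneg (f.shift τ) j)
    (fun τ _ _ => hf.integral_optMBound_shift_le_theta hS j τ) V
  refine ⟨m, hm, hmθ, fun x hx => hbound (fun τ u => f.shift τ (u, x u)) _
    (g.locallyIntegrable_comp hx.1) (fun τ => ?_)
    fun p q _ => tendsto_integral_of_tendsto_car h hx p q⟩
  filter_upwards [((hS.shift τ).isMBound_optMBound j).2] with u hu
  exact hu _ (hx.2.1 u)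

lemma HasEquicontinuousMBounds.exists_isMBound_of_tendsto_shift
    (hf : HasEquicontinuousMBounds f) (hS : IsSC f) (hg : IsSC g) (hΘ : IsModulus (Θ j))
    (h : Tendsto f.shift U (@nhds _ (carTopology mode Θ N V) g)) :
    ∃ m : ℝ → ℝ, IsMBound g (Metric.closedBall 0 j) m ∧
      ∀ a b, a ≤ b → ∫ u in a..b, m u ≤ theta f j (b - a) := by
  obtain ⟨m, hm, hmθ, hbound⟩ := hf.exists_bound_of_tendsto_shift hS h j
  obtain ⟨D, hDc, hD⟩ := TopologicalSpace.exists_countable_dense (Metric.closedBall (0 : Euc N) j)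
  have : Countable D := hDc.to_subtype
  refine ⟨m, ⟨hm, ?_⟩, hmθ⟩
  filter_upwards [hg, ae_all_iff.2 fun d : D => hbound _ (const_mem_modCurves hΘ d.1.2)]
    with t hgt hDt x hx
  exact hD.denseRange_val.induction_on
    (p := fun x : Metric.closedBall (0 : Euc N) j => ‖g (t, (x : Euc N))‖ ≤ m t) ⟨x, hx⟩
    (isClosed_le (hgt.comp continuous_subtype_val).norm continuous_const) hDt

end Topology

section Solutions

variable {N : ℕ}

lemma locallyIntegrable_comp_add_right {E : Type*} [NormedAddCommGroup E] {l : ℝ → E}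
    (hl : LocallyIntegrable l) (τ : ℝ) : LocallyIntegrable fun t => l (t + τ) := by
  refine locallyIntegrable_iff.2 fun k hk => ?_
  have hk' := hl.integrableOn_isCompact (hk.image (continuous_add_const τ))
  exact (((measurePreserving_add_right volume τ).integrableOn_comp_preimage
    (Homeomorph.addRight τ).measurableEmbedding).2 hk').mono_set (subset_preimage_image _ _)

lemma IsLC.shift {V : Type*} [NormedAddCommGroup V] [NormedSpace ℝ V] [MeasurableSpace V]
    [BorelSpace V] [SecondCountableTopology V] {g : Car N V} (hg : IsLC g) (τ : ℝ) :
    IsLC (g.shift τ) := fun K hK =>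
  let ⟨_, hl, h⟩ := hg K hK
  ⟨_, locallyIntegrable_comp_add_right hl τ,
    (measurePreserving_add_right (volume : Measure ℝ) τ).quasiMeasurePreserving.ae h⟩

variable {g : Car N (Euc N)} {x₀ : Euc N} {x y : ℝ → Euc N}

lemma IsSolution.sub_eq_integral (hx : IsSolution g x₀ x) (s t : ℝ) :
    x t - x s = ∫ u in s..t, g (u, x u) := by
  have hi := intervalIntegrable_of_locallyIntegrable (g.locallyIntegrable_comp hx.1)
  rw [hx.2 t, hx.2 s, add_sub_add_left_eq_sub,
    intervalIntegral.integral_interval_sub_left (hi _ _) (hi _ _)]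

lemma IsSolution.norm_sub_le_mul_bieleckiWeight {g₁ g₂ : Car N (Euc N)} {x₁ x₂ : Euc N}
    {l : ℝ → ℝ} {K : Set (Euc N)} {ε T : ℝ} (hx : IsSolution g₁ x₁ x) (hy : IsSolution g₂ x₂ y)
    (hl : LocallyIntegrable l)
    (hLip : ∀ᵐ t, ∀ a ∈ K, ∀ b ∈ K, ‖g₂ (t, a) - g₂ (t, b)‖ ≤ l t * ‖a - b‖)
    (hxK : ∀ s, |s| ≤ T → x s ∈ K) (hyK : ∀ s, |s| ≤ T → y s ∈ K)
    (hε : ∀ s, |s| ≤ T → ‖x₁ - x₂‖ + ‖∫ u in (0 : ℝ)..s, (g₁ - g₂) (u, x u)‖ ≤ ε)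
    {t : ℝ} (ht : |t| ≤ T) :
    ‖x t - y t‖ ≤ 2 * ε * bieleckiWeight (fun s => ‖l s‖) t := by
  refine le_mul_bieleckiWeight_of_le_add_integral (u := fun s => ‖x s - y s‖)
    (locallyIntegrable_norm hl) (fun _ => norm_nonneg _) (hx.1.sub hy.1).norm
    (fun _ => norm_nonneg _) (fun s hs => ?_) ht
  have hdiff : x s - y s = (x₁ - x₂) + (∫ u in (0 : ℝ)..s, (g₁ - g₂) (u, x u)) +
      ∫ u in (0 : ℝ)..s, (g₂ (u, x u) - g₂ (u, y u)) := by
    have hi (g : Car N (Euc N)) {z : ℝ → Euc N} (hz : Continuous z) :=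
      intervalIntegrable_of_locallyIntegrable (g.locallyIntegrable_comp hz) 0 s
    simp only [Car.sub_apply]
    rw [intervalIntegral.integral_sub (hi g₁ hx.1) (hi g₂ hx.1),
      intervalIntegral.integral_sub (hi g₂ hx.1) (hi g₂ hy.1), hx.2 s, hy.2 s]
    abel
  have hlip : ‖∫ u in (0 : ℝ)..s, (g₂ (u, x u) - g₂ (u, y u))‖ ≤
      |∫ u in (0 : ℝ)..s, ‖l u‖ * ‖x u - y u‖| := by
    refine intervalIntegral.norm_integral_le_abs_of_norm_le ?_
      (intervalIntegrable_of_locallyIntegrable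
        ((locallyIntegrable_norm hl).mul_continuous (hx.1.sub hy.1).norm) _ _)
    filter_upwards [ae_restrict_of_ae hLip, ae_restrict_mem measurableSet_uIoc] with u hu hus
    have huT := (abs_le_abs_of_mem_uIoc_zero hus).trans hs
    exact (hu _ (hxK u huT) _ (hyK u huT)).trans (by gcongr; exact le_abs_self _)
  rw [hdiff]
  exact (norm_add_le _ _).trans (add_le_add ((norm_add_le _ _).trans (hε s hs)) hlip)

lemma IsSolution.eq_of_isLC (hx : IsSolution g x₀ x) (hy : IsSolution g x₀ y) (hg : IsLC g) :
    x = y := by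
  funext t
  have hcompact : IsCompact (Icc (-|t|) |t|) := isCompact_Icc
  obtain ⟨l, hl, hLip⟩ := hg _ ((hcompact.image hx.1).union (hcompact.image hy.1))
  have hself (z : ℝ × Euc N) : (g - g) z = 0 := sub_self (g z)
  have hgronwall := hx.norm_sub_le_mul_bieleckiWeight (ε := 0) hy hl hLip
    (fun s hs => .inl (mem_image_of_mem x (abs_le.1 hs)))
    (fun s hs => .inr (mem_image_of_mem y (abs_le.1 hs)))
    (fun s _ => by simp only [hself, sub_self x₀, norm_zero, intervalIntegral.integral_zero,
      add_zero, le_refl]) le_rfl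
  rw [mul_zero, zero_mul] at hgronwall
  exact sub_eq_zero.1 (norm_le_zero_iff.1 hgronwall)

lemma isSolution_sol (h : ∃ x, IsSolution g x₀ x) : IsSolution g x₀ (sol g x₀) := by
  rw [sol, dif_pos h]
  exact h.choose_spec

lemma IsSolution.sol_eq (h : IsSolution g x₀ x) (hg : IsLC g) : sol g x₀ = x :=
  (isSolution_sol ⟨x, h⟩).eq_of_isLC h hg

lemma IsSolution.shift (h : IsSolution g x₀ x) (τ : ℝ) :
    IsSolution (g.shift τ) (x τ) fun s => x (s + τ) := by
  refine ⟨h.1.comp (continuous_add_const τ), fun t => ?_⟩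
  simp only [Car.shift_apply]
  rw [intervalIntegral.integral_comp_add_right (fun s => g (s, x s)), zero_add,
    ← h.sub_eq_integral, add_sub_cancel]

end Solutions

section Flow

variable {N : ℕ} {ω : Triple N}

/-- The solution `x(·, g, x₀)` attached to a triple `ω = (g, G, x₀)`. -/
noncomputable def Triple.traj (ω : Triple N) : ℝ → Euc N := sol ω.1 ω.2.2

/-- The coefficient matrix `s ↦ G(s, x(s, g, x₀))` along the solution attached to a triple. It
agrees with `s ↦ A(ω_s)` only almost everywhere, but it satisfies the cocycle identity
everywhere. -/
noncomputable def Triple.coeff (ω : Triple N) (s : ℝ) : Mat N := ω.2.1 (s, ω.traj s)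

lemma coeffA_eq_of_tendsto {L : Mat N}
    (h : Tendsto (fun r : ℝ => r⁻¹ • ∫ s in (0 : ℝ)..r, ω.coeff s) (𝓝[≠] 0) (𝓝 L)) :
    coeffA ω = L := by
  have hex : ∃ L : Mat N, Tendsto (fun r : ℝ => r⁻¹ • ∫ s in (0 : ℝ)..r,
      ω.2.1 (s, sol ω.1 ω.2.2 s)) (𝓝[≠] 0) (𝓝 L) := ⟨L, h⟩
  rw [coeffA, dif_pos hex]
  exact tendsto_nhds_unique hex.choose_spec h

/-- The triples `(g, G, x₀)` for which the initial value problem `ẋ = g(t, x)`, `x(0) = x₀` has a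
unique global solution because `g ∈ 𝔏ℭ`. -/
structure IsWellPosed (ω : Triple N) : Prop where
  isLC : IsLC ω.1
  exists_isSolution : ∃ x, IsSolution ω.1 ω.2.2 x

namespace IsWellPosed

lemma isSolution_traj (h : IsWellPosed ω) : IsSolution ω.1 ω.2.2 ω.traj :=
  isSolution_sol h.exists_isSolution

lemma continuous_traj (h : IsWellPosed ω) : Continuous ω.traj := h.isSolution_traj.1

lemma traj_zero (h : IsWellPosed ω) : ω.traj 0 = ω.2.2 := by
  simpa only [intervalIntegral.integral_same, add_zero] using h.isSolution_traj.2 0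

lemma traj_baseFlow (h : IsWellPosed ω) (t s : ℝ) : (baseFlow t ω).traj s = ω.traj (s + t) :=
  congrFun ((h.isSolution_traj.shift t).sol_eq (h.isLC.shift t)) s

lemma coeff_baseFlow (h : IsWellPosed ω) (t s : ℝ) : (baseFlow t ω).coeff s = ω.coeff (s + t) := by
  rw [Triple.coeff, h.traj_baseFlow]
  rfl

lemma baseFlow_zero (h : IsWellPosed ω) : baseFlow 0 ω = ω := by
  rw [baseFlow, Car.shift_zero, Car.shift_zero, show sol ω.1 ω.2.2 0 = ω.2.2 from h.traj_zero]

lemma baseFlow_baseFlow (h : IsWellPosed ω) (s t : ℝ) :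
    baseFlow s (baseFlow t ω) = baseFlow (s + t) ω :=
  Prod.ext (Car.shift_shift _ _ _) <| Prod.ext (Car.shift_shift _ _ _) (h.traj_baseFlow t s)

protected lemma baseFlow (h : IsWellPosed ω) (t : ℝ) : IsWellPosed (baseFlow t ω) :=
  ⟨h.isLC.shift t, _, h.isSolution_traj.shift t⟩

lemma locallyIntegrable_coeff (h : IsWellPosed ω) : LocallyIntegrable ω.coeff :=
  ω.2.1.locallyIntegrable_comp h.continuous_traj

lemma ae_coeffA_baseFlow (h : IsWellPosed ω) : ∀ᵐ s : ℝ, coeffA (baseFlow s ω) = ω.coeff s := by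
  filter_upwards [_root_.LocallyIntegrable.ae_hasDerivAt_integral h.locallyIntegrable_coeff]
    with s hs
  refine coeffA_eq_of_tendsto ((hasDerivAt_iff_tendsto_slope_zero.1 (hs s)).congr fun r => ?_)
  simp only [h.coeff_baseFlow]
  rw [intervalIntegral.integral_same, sub_zero,
    intervalIntegral.integral_comp_add_right, zero_add, add_comm r s]

lemma isFundamental_iff_isPrincipal (h : IsWellPosed ω) {Φ : ℝ → Mat N} :
    IsFundamental ω Φ ↔ IsPrincipal ω.coeff Φ := by
  refine and_congr_right fun _ => forall_congr' fun t => ?_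
  rw [intervalIntegral.integral_congr_ae (g := fun s => ω.coeff s * Φ s)
    (h.ae_coeffA_baseFlow.mono fun s hs _ => by rw [hs])]

lemma isPrincipal_fundMat (h : IsWellPosed ω) : IsPrincipal ω.coeff fun t => fundMat t ω := by
  have hex : ∃ Φ, IsFundamental ω Φ :=
    (exists_isPrincipal h.locallyIntegrable_coeff).imp fun _ => h.isFundamental_iff_isPrincipal.2
  simp only [fundMat, dif_pos hex]
  exact h.isFundamental_iff_isPrincipal.1 hex.choose_spec

lemma fundMat_zero (h : IsWellPosed ω) : fundMat 0 ω = 1 := by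
  simpa only [intervalIntegral.integral_same, add_zero] using h.isPrincipal_fundMat.2 0

lemma fundMat_add (h : IsWellPosed ω) (t s : ℝ) :
    fundMat (t + s) ω = fundMat t (baseFlow s ω) * fundMat s ω := by
  have hs := h.baseFlow s
  have hΦ := h.isPrincipal_fundMat
  refine congrFun (eq_of_eq_add_integral_mul (c := fundMat s ω) (Φ := fun t => fundMat (t + s) ω)
    (Ψ := fun t => fundMat t (baseFlow s ω) * fundMat s ω) hs.locallyIntegrable_coeff
    (hΦ.1.comp (continuous_add_const s)) (hs.isPrincipal_fundMat.1.mul continuous_const)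
    (fun r => ?_) (hs.isPrincipal_fundMat.mul_const_eq hs.locallyIntegrable_coeff _)) t
  simp only [h.coeff_baseFlow]
  rw [intervalIntegral.integral_comp_add_right (fun u => ω.coeff u * fundMat u ω), zero_add]
  exact hΦ.eq_add_integral h.locallyIntegrable_coeff s (r + s)

lemma fundMat_neg_mul_fundMat (h : IsWellPosed ω) (s : ℝ) :
    fundMat (-s) (baseFlow s ω) * fundMat s ω = 1 := by
  rw [← h.fundMat_add, neg_add_cancel, h.fundMat_zero]

lemma fundMat_mul_fundMat_neg (h : IsWellPosed ω) (s : ℝ) :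
    fundMat s ω * fundMat (-s) (baseFlow s ω) = 1 := by
  have hs := (h.baseFlow s).fundMat_neg_mul_fundMat (-s)
  rwa [neg_neg, h.baseFlow_baseFlow, neg_add_cancel, h.baseFlow_zero] at hs

lemma isUnit_fundMat (h : IsWellPosed ω) (s : ℝ) : IsUnit (fundMat s ω) :=
  ⟨⟨_, _, h.fundMat_mul_fundMat_neg s, h.fundMat_neg_mul_fundMat s⟩, rfl⟩

end IsWellPosed

/-- The well-posed triples `(g, G, x₀)` for which `g`, and in the weak setting also `G` along the
curves of `modCurves`, has bounds with primitives controlled by the moduli `Θ` and `ρ`. These are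
the properties that limits of translates inherit. -/
structure IsRegular (mode : Mode) (Θ ρ : ℕ → ℝ → ℝ) (ω : Triple N) : Prop
    extends IsWellPosed ω where
  exists_isMBound : ∀ j : ℕ, ∃ m, IsMBound ω.1 (Metric.closedBall 0 j) m ∧
    ∀ a b, a ≤ b → ∫ u in a..b, m u ≤ Θ j (b - a)
  exists_bound : mode = .weak → ∀ j : ℕ, ∃ m : ℝ → ℝ, LocallyIntegrable m ∧
    (∀ a b, a ≤ b → ∫ u in a..b, m u ≤ ρ j (b - a)) ∧
    ∀ x ∈ modCurves N Θ j, ∀ᵐ u, ‖ω.2.1 (u, x u)‖ ≤ m u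

namespace IsRegular

variable {mode : Mode} {Θ ρ : ℕ → ℝ → ℝ}

protected lemma baseFlow (h : IsRegular mode Θ ρ ω) (τ : ℝ) :
    IsRegular mode Θ ρ (baseFlow τ ω) where
  toIsWellPosed := h.toIsWellPosed.baseFlow τ
  exists_isMBound j := by
    obtain ⟨m, hm, hmΘ⟩ := h.exists_isMBound j
    refine ⟨_, hm.shift τ, fun a b hab => ?_⟩
    rw [intervalIntegral.integral_comp_add_right, ← add_sub_add_right_eq_sub b a τ]
    exact hmΘ _ _ (by linarith)
  exists_bound hmode j := by
    obtain ⟨m, hm, hmρ, hbound⟩ := h.exists_bound hmode j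
    refine ⟨_, locallyIntegrable_comp_add_right hm τ, fun a b hab => ?_, fun x hx => ?_⟩
    · rw [intervalIntegral.integral_comp_add_right, ← add_sub_add_right_eq_sub b a τ]
      exact hmρ _ _ (by linarith)
    · have hx' : (fun u => x (u - τ)) ∈ modCurves N Θ j :=
        ⟨hx.1.comp (continuous_sub_right τ), fun t => hx.2.1 _, fun s t => by
          simpa only [sub_sub_sub_cancel_right] using hx.2.2 (s - τ) (t - τ)⟩
      filter_upwards [(measurePreserving_add_right volume τ).quasiMeasurePreserving.ae
        (hbound _ hx')] with u hu
      simp only [add_sub_cancel_right] at hu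
      exact hu

lemma norm_traj_sub_le (h : IsRegular mode Θ ρ ω) {a b : ℝ} {j : ℕ}
    (hj : ∀ t ∈ Icc a b, ω.traj t ∈ Metric.closedBall 0 j) :
    ∀ s ∈ Icc a b, ∀ t ∈ Icc a b, ‖ω.traj t - ω.traj s‖ ≤ Θ j |t - s| := by
  intro s hs t ht
  wlog hst : s ≤ t generalizing s t
  · rw [norm_sub_rev, abs_sub_comm]
    exact this t ht s hs (le_of_not_ge hst)
  obtain ⟨m, hm, hmΘ⟩ := h.exists_isMBound j
  rw [h.isSolution_traj.sub_eq_integral, abs_of_nonneg (sub_nonneg.2 hst)]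
  refine (intervalIntegral.norm_integral_le_of_norm_le hst (hm.2.mono fun u hu hust => ?_)
    (intervalIntegrable_of_locallyIntegrable hm.1 _ _)).trans (hmΘ s t hst)
  exact hu _ (hj u ⟨hs.1.trans hust.1.le, hust.2.trans ht.2⟩)

lemma IccExtend_traj_mem_modCurves (h : IsRegular mode Θ ρ ω) {j : ℕ} (hΘ : IsModulus (Θ j))
    {a b : ℝ} (hab : a ≤ b) (hj : ∀ t ∈ Icc a b, ω.traj t ∈ Metric.closedBall 0 j) :
    IccExtend hab (fun t : Icc a b => ω.traj t) ∈ modCurves N Θ j :=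
  IccExtend_mem_modCurves hΘ hab h.continuous_traj hj (h.norm_traj_sub_le hj)

end IsRegular

end Flow

section ContinuousDependence

lemma forall_abs_le_of_bootstrap {u : ℝ → ℝ} (hu : Continuous u) {c r : ℝ} (hc : c < 1)
    (h0 : u 0 ≤ c)
    (h : ∀ T, 0 ≤ T → T ≤ r → (∀ t, |t| ≤ T → u t ≤ 1) → ∀ t, |t| ≤ T → u t ≤ c)
    {t : ℝ} (ht : |t| ≤ r) : u t ≤ c := by
  set v : ℝ → ℝ := fun T => max (u T) (u (-T)) with hv
  have hvc : Continuous v := by fun_prop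
  have huv : ∀ t, u t ≤ v |t| := fun t => by
    rcases abs_choice t with h | h <;> rw [h] <;> simp [hv]
  have hivt : ∀ T, 0 ≤ T → 1 ≤ v T → ∃ S ∈ Icc 0 T, v S = 1 := fun T hT h1 =>
    intermediate_value_Icc hT hvc.continuousOn ⟨by simpa [hv] using h0.trans hc.le, h1⟩
  suffices hlt : ∀ T ∈ Icc 0 r, v T < 1 from
    h r ((abs_nonneg t).trans ht) le_rfl
      (fun s hs => (huv s).trans (hlt _ ⟨abs_nonneg s, hs⟩).le) t ht
  by_contra! ⟨T₁, hT₁, hvT₁⟩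
  obtain ⟨S₁, hS₁, hvS₁⟩ := hivt T₁ hT₁.1 hvT₁
  obtain ⟨T₀, ⟨hT₀, hvT₀⟩, hleast⟩ := (isCompact_Icc.inter_right
    (isClosed_singleton.preimage hvc)).exists_isLeast ⟨S₁, ⟨hS₁.1, hS₁.2.trans hT₁.2⟩, hvS₁⟩
  have hle_one : ∀ s, |s| ≤ T₀ → u s ≤ 1 := fun s hs => (huv s).trans <| by
    by_contra! hgt
    obtain ⟨S, hS, hvS⟩ := hivt |s| (abs_nonneg s) hgt.le
    have hT₀S : T₀ ≤ S := hleast ⟨⟨hS.1, hS.2.trans (hs.trans hT₀.2)⟩, hvS⟩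
    rw [← le_antisymm hS.2 (hs.trans hT₀S)] at hgt
    exact hgt.ne' hvS
  have hle := h T₀ hT₀.1 hT₀.2 hle_one
  have habs : |T₀| ≤ T₀ := (abs_of_nonneg hT₀.1).le
  exact (max_le (hle T₀ habs) (hle (-T₀) ((abs_neg T₀).trans_le habs))).not_gt
    (hc.trans_eq (mem_singleton_iff.1 hvT₀).symm)

lemma abs_integral_norm_le_of_ae_le {E : Type*} [NormedAddCommGroup E] {B : ℝ → E} {m θ : ℝ → ℝ}
    (hm : LocallyIntegrable m) (hmθ : ∀ a b, a ≤ b → ∫ u in a..b, m u ≤ θ (b - a))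
    (hB : ∀ᵐ u, ‖B u‖ ≤ m u) (s t : ℝ) : |∫ u in s..t, ‖B u‖| ≤ θ |t - s| := by
  wlog hst : s ≤ t generalizing s t
  · rw [intervalIntegral.integral_symm, abs_neg, abs_sub_comm]
    exact this t s (le_of_not_ge hst)
  rw [abs_of_nonneg (sub_nonneg.2 hst), ← Real.norm_eq_abs]
  refine (intervalIntegral.norm_integral_le_of_norm_le hst ?_
    (intervalIntegrable_of_locallyIntegrable hm _ _)).trans (hmθ s t hst)
  filter_upwards [hB] with u hu _
  rwa [norm_norm]

variable {N : ℕ} {mode : Mode} {Θ : ℕ → ℝ → ℝ} {j : ℕ} {ι : Type*} {F : Filter ι}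

lemma eventually_norm_integral_sub_le {V : Type*} [NormedAddCommGroup V] [NormedSpace ℝ V]
    [MeasurableSpace V] [BorelSpace V] [SecondCountableTopology V] {g : ι → Car N V} {g' : Car N V}
    (h : Tendsto g F (@nhds _ (carTopology mode Θ N V) g')) (hΘ : IsModulus (Θ j))
    (hg : ∀ᶠ n in F, ∃ m, IsMBound (g n) (Metric.closedBall 0 j) m ∧
      ∀ a b, a ≤ b → ∫ u in a..b, m u ≤ Θ j (b - a))
    (hg' : ∃ m, IsMBound g' (Metric.closedBall 0 j) m ∧
      ∀ a b, a ≤ b → ∫ u in a..b, m u ≤ Θ j (b - a)) (r : ℝ) {ε : ℝ} (hε : 0 < ε) :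
    ∀ᶠ n in F, ∀ x ∈ modCurves N Θ j, ∀ t, |t| ≤ r →
      ‖∫ u in (0 : ℝ)..t, (g n - g') (u, x u)‖ ≤ ε := by
  have hequi : EventuallyEquiintegrable (F ×ˢ 𝓟 (modCurves N Θ j))
      fun (n : ι × (ℝ → Euc N)) u => (g n.1 - g') (u, n.2 u) := by
    intro r ε hε
    obtain ⟨δ, hδ, hsmall⟩ := hΘ.exists_forall_abs_le (half_pos hε)
    obtain ⟨m', hm', hmΘ'⟩ := hg'
    refine ⟨δ, hδ, eventually_prod_principal_iff.2 ?_⟩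
    filter_upwards [hg] with n ⟨m, hm, hmΘ⟩ x hx s _ t _ hst
    refine (abs_integral_norm_le_of_ae_le (θ := fun s => Θ j s + Θ j s) (hm.1.add hm'.1)
      (fun a b hab => ?_) ?_ s t).trans
      ((add_le_add (hsmall s t hst) (hsmall s t hst)).trans_eq (add_halves ε))
    · simp only [Pi.add_apply]
      rw [intervalIntegral.integral_add (intervalIntegrable_of_locallyIntegrable hm.1 _ _)
        (intervalIntegrable_of_locallyIntegrable hm'.1 _ _)]
      exact add_le_add (hmΘ a b hab) (hmΘ' a b hab)
    · filter_upwards [hm.2, hm'.2] with u hu hu'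
      exact (norm_sub_le _ _).trans (add_le_add (hu _ (hx.2.1 u)) (hu' _ (hx.2.1 u)))
  refine eventually_prod_principal_iff.1 (hequi.eventually_norm_integral_le
    (eventually_prod_principal_iff.2 (Eventually.of_forall fun n x hx =>
      (g n - g').locallyIntegrable_comp hx.1)) (fun q => ?_) r hε)
  simpa only [Rat.cast_zero] using tendsto_integral_sub_of_tendsto_car h j 0 q

variable {ρ : ℕ → ℝ → ℝ} {ω : ι → Triple N} {ω' : Triple N}

lemma IsWellPosed.exists_norm_traj_add_one_le (h : IsWellPosed ω') (r : ℝ) :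
    ∃ j : ℕ, ∀ t, |t| ≤ r → ‖ω'.traj t‖ + 1 ≤ j := by
  obtain ⟨C, hC⟩ := (isCompact_Icc (a := -r) (b := r)).exists_bound_of_continuousOn
    h.continuous_traj.continuousOn
  obtain ⟨j, hj⟩ := exists_nat_ge (C + 1)
  exact ⟨j, fun t ht => (add_le_add_left (hC t (abs_le.1 ht)) 1).trans hj⟩

lemma mem_closedBall_of_norm_sub_le_one {E : Type*} [SeminormedAddCommGroup E] {x y : E} {R : ℝ}
    (hxy : ‖x - y‖ ≤ 1) (hy : ‖y‖ + 1 ≤ R) : x ∈ Metric.closedBall 0 R := by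
  rw [mem_closedBall_zero_iff]
  linarith [norm_le_norm_add_norm_sub' x y]

lemma IsRegular.norm_traj_sub_traj_le {ω₁ ω₂ : Triple N} (h₁ : IsRegular mode Θ ρ ω₁)
    (h₂ : IsWellPosed ω₂) (hΘ : IsModulus (Θ j)) {l : ℝ → ℝ} (hl : LocallyIntegrable l)
    (hLip : ∀ᵐ t, ∀ a ∈ Metric.closedBall 0 (j : ℝ), ∀ b ∈ Metric.closedBall 0 (j : ℝ),
      ‖ω₂.1 (t, a) - ω₂.1 (t, b)‖ ≤ l t * ‖a - b‖) {T δ ε : ℝ}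
    (hball₁ : ∀ s, |s| ≤ T → ω₁.traj s ∈ Metric.closedBall 0 j)
    (hball₂ : ∀ s, |s| ≤ T → ω₂.traj s ∈ Metric.closedBall 0 j)
    (hx : ‖ω₁.2.2 - ω₂.2.2‖ ≤ δ)
    (hint : ∀ x ∈ modCurves N Θ j, ∀ t, |t| ≤ T →
      ‖∫ u in (0 : ℝ)..t, (ω₁.1 - ω₂.1) (u, x u)‖ ≤ ε) {t : ℝ} (ht : |t| ≤ T) :
    ‖ω₁.traj t - ω₂.traj t‖ ≤ 2 * (δ + ε) * bieleckiWeight (fun s => ‖l s‖) t := by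
  have hT : 0 ≤ T := (abs_nonneg t).trans ht
  refine h₁.isSolution_traj.norm_sub_le_mul_bieleckiWeight h₂.isSolution_traj hl hLip hball₁ hball₂
    (fun s hs => ?_) ht
  have hclamp := h₁.IccExtend_traj_mem_modCurves hΘ (neg_le_self hT)
    fun s hs => hball₁ s (abs_le.2 hs)
  refine add_le_add hx ((hint _ hclamp s hs).trans' (le_of_eq ?_))
  congr 1
  refine intervalIntegral.integral_congr fun u hu => ?_
  have huT : |u| ≤ T := by simpa using (abs_sub_left_of_mem_uIcc hu).trans (by simpa using hs)
  simp only [IccExtend_of_mem _ _ (abs_le.1 huT)]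

lemma eventually_norm_traj_sub_le (hΘ : ∀ j, IsModulus (Θ j))
    (hω : ∀ᶠ n in F, IsRegular mode Θ ρ (ω n)) (hω' : IsRegular mode Θ ρ ω')
    (hg : Tendsto (fun n => (ω n).1) F (@nhds _ (carTopology mode Θ N (Euc N)) ω'.1))
    (hx : Tendsto (fun n => (ω n).2.2) F (𝓝 ω'.2.2)) (r : ℝ) {ε : ℝ} (hε : 0 < ε) :
    ∀ᶠ n in F, ∀ t, |t| ≤ r → ‖(ω n).traj t - ω'.traj t‖ ≤ ε := by
  obtain ⟨j, hj⟩ := hω'.exists_norm_traj_add_one_le r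
  obtain ⟨l, hl, hLip⟩ := hω'.isLC _ (isCompact_closedBall (0 : Euc N) (j : ℝ))
  obtain ⟨C, hC⟩ := (isCompact_Icc (a := -r) (b := r)).bddAbove_image
    (continuous_bieleckiWeight (locallyIntegrable_norm hl)).continuousOn
  have hc0 : 0 < min ε (1 / 2) := lt_min hε one_half_pos
  set c := min ε (1 / 2)
  have hC0 : 0 < 2 * max 1 C := by positivity
  set ε₁ := c / (2 * max 1 C)
  have hε₁ : 0 < ε₁ := div_pos hc0 hC0
  filter_upwards [hω, eventually_norm_integral_sub_le hg (hΘ j)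
    (hω.mono fun n hn => hn.exists_isMBound j) (hω'.exists_isMBound j) r (half_pos hε₁),
    Metric.tendsto_nhds.1 hx (ε₁ / 2) (half_pos hε₁)] with n hn hint hxn t ht
  rw [dist_eq_norm] at hxn
  refine (forall_abs_le_of_bootstrap (u := fun t => ‖(ω n).traj t - ω'.traj t‖)
    (hn.continuous_traj.sub hω'.continuous_traj).norm ((min_le_right ε _).trans_lt one_half_lt_one)
    ?_ (fun T _ hTr hone s hs => ?_) ht).trans (min_le_left _ _)
  · rw [hn.traj_zero, hω'.traj_zero]
    refine hxn.le.trans ((half_le_self hε₁.le).trans (div_le_self hc0.le ?_))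
    linarith [le_max_left 1 C]
  have hball : ∀ s, |s| ≤ T → (ω n).traj s ∈ Metric.closedBall 0 (j : ℝ) := fun s hs =>
    mem_closedBall_of_norm_sub_le_one (hone s hs) (hj s (hs.trans hTr))
  have hball' : ∀ s, |s| ≤ T → ω'.traj s ∈ Metric.closedBall 0 (j : ℝ) := fun s hs =>
    mem_closedBall_of_norm_sub_le_one (by simp) (hj s (hs.trans hTr))
  calc ‖(ω n).traj s - ω'.traj s‖
      ≤ 2 * (ε₁ / 2 + ε₁ / 2) * bieleckiWeight (fun s => ‖l s‖) s :=
        hn.norm_traj_sub_traj_le hω'.toIsWellPosed (hΘ j) hl hLip hball hball' hxn.le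
          (fun x hx t ht => hint x hx t (ht.trans hTr)) hs
    _ ≤ 2 * ε₁ * max 1 C := by
        rw [add_halves]
        gcongr
        exact (hC (mem_image_of_mem _ (abs_le.1 (hs.trans hTr)))).trans (le_max_right 1 C)
    _ = c := by rw [mul_right_comm, mul_div_cancel₀ _ hC0.ne']

end ContinuousDependence

section Coefficients

variable {N : ℕ} {mode : Mode} {Θ : ℕ → ℝ → ℝ} {j : ℕ} {ι : Type*} {F : Filter ι}

lemma tendsto_of_forall_seq {α E β : Type*} [PseudoMetricSpace E] [TopologicalSpace β]
    {S : Set (α → E)} {I : Set α} {y : α → E} {J : (α → E) → β} {c : β}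
    (h : ∀ x : ℕ → α → E, (∀ n, x n ∈ S) → TendstoUniformlyOn x y atTop I →
      Tendsto (fun n => J (x n)) atTop (𝓝 c))
    {x : ι → α → E} (hx : ∀ᶠ n in F, x n ∈ S) (hxy : TendstoUniformlyOn x y F I) :
    Tendsto (fun n => J (x n)) F (𝓝 c) := by
  by_contra hne
  obtain ⟨W, hW, hfreq⟩ := not_tendsto_iff_exists_frequently_notMem.1 hne
  have hk (k : ℕ) : ∃ n, J (x n) ∉ W ∧ x n ∈ S ∧ ∀ t ∈ I, dist (y t) (x n t) < 1 / ((k : ℝ) + 1) :=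
    (hfreq.and_eventually
      (hx.and (Metric.tendstoUniformlyOn_iff.1 hxy _ Nat.one_div_pos_of_nat))).exists
  choose m hmW hmS hmI using hk
  have hu : TendstoUniformlyOn (fun k => x (m k)) y atTop I :=
    Metric.tendstoUniformlyOn_iff.2 fun η hη => by
      filter_upwards [tendsto_one_div_add_atTop_nhds_zero_nat.eventually_lt_const hη]
        with k hk t ht
      exact (hmI k t ht).trans hk
  obtain ⟨k, hkW⟩ := ((h _ hmS hu).eventually hW).exists
  exact hmW k hkW

section CarV

variable {V : Type*} [NormedAddCommGroup V] [NormedSpace ℝ V] [MeasurableSpace V] [BorelSpace V]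
  [SecondCountableTopology V] {u : ι → Car N V} {g : Car N V} {y : ι → ℝ → Euc N}
  {y' : ℝ → Euc N}

lemma IsTC.isWTC (h : IsTC Θ g) : IsWTC Θ g := fun q j x y hx hy hxy => by
  have hi (z : ℝ → Euc N) (hz : z ∈ modSet N Θ q j) :
      IntegrableOn (fun t => g (t, z t)) (Icc (q.1 : ℝ) q.2) :=
    let ⟨_, hC⟩ := g.exists_bound Θ q j
    (hC z hz).1
  refine tendsto_iff_norm_sub_tendsto_zero.2 (squeeze_zero (fun _ => norm_nonneg _) (fun n => ?_)
    (h q j x y hx hy hxy))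
  rw [← integral_sub (hi _ (hx n)) (hi _ hy)]
  exact norm_integral_le_integral_norm _

lemma IsThetaC.isWTC (h : IsThetaC mode Θ g) : IsWTC Θ g :=
  match mode, h with
  | .strong, h => IsTC.isWTC h
  | .weak, h => h

lemma tendsto_integral_comp_of_tendsto_car
    (hu : Tendsto u F (@nhds _ (carTopology mode Θ N V) g)) (hg : IsThetaC mode Θ g)
    (hy : ∀ᶠ n in F, y n ∈ modCurves N Θ j) (hy' : y' ∈ modCurves N Θ j)
    (hyy' : TendstoUniformly y y' F) (p q : ℚ) :
    Tendsto (fun n => ∫ t in (p : ℝ)..q, u n (t, y n t)) F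
      (𝓝 (∫ t in (p : ℝ)..q, g (t, y' t))) := by
  wlog hpq : p ≤ q generalizing p q
  · simpa only [← intervalIntegral.integral_symm] using (this q p (le_of_not_ge hpq)).neg
  have hcurve : Tendsto (fun n => ∫ t in (p : ℝ)..q, g (t, y n t)) F
      (𝓝 (∫ t in (p : ℝ)..q, g (t, y' t))) := by
    simp only [intervalIntegral.integral_of_le (Rat.cast_le.2 hpq), ← integral_Icc_eq_integral_Ioc]
    exact tendsto_of_forall_seq (J := fun x => ∫ t in Icc (p : ℝ) q, g (t, x t))
      (fun x hx hxy => hg.isWTC (p, q) j x _ hx (modCurves_subset_modSet _ hy') hxy)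
      (hy.mono fun _ hn => modCurves_subset_modSet _ hn) hyy'.tendstoUniformlyOn
  have hdiff := (tendsto_integral_sub_of_tendsto_car hu j p q).comp
    (tendsto_id.prodMk (tendsto_principal.2 hy))
  refine (zero_add (∫ t in (p : ℝ)..q, g (t, y' t)) ▸ hdiff.add hcurve).congr' ?_
  filter_upwards [hy] with n hn
  have hi (k : Car N V) := intervalIntegrable_of_locallyIntegrable
    (k.locallyIntegrable_comp hn.1) (p : ℝ) q
  simp only [Function.comp_apply, id_eq, Car.sub_apply]
  rw [intervalIntegral.integral_sub (hi _) (hi _), sub_add_cancel]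

lemma tendsto_integral_norm_sub_comp_of_tendsto_car
    (hu : Tendsto u F (@nhds _ (carTopology .strong Θ N V) g)) (hg : IsTC Θ g)
    (hy : ∀ᶠ n in F, y n ∈ modCurves N Θ j) (hy' : y' ∈ modCurves N Θ j)
    (hyy' : TendstoUniformly y y' F) (q : ℚ × ℚ) :
    Tendsto (fun n => ∫ t in Icc (q.1 : ℝ) q.2, ‖u n (t, y n t) - g (t, y' t)‖) F (𝓝 0) := by
  have hcurve : Tendsto (fun n => ∫ t in Icc (q.1 : ℝ) q.2, ‖g (t, y n t) - g (t, y' t)‖) F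
      (𝓝 0) :=
    tendsto_of_forall_seq (J := fun x => ∫ t in Icc (q.1 : ℝ) q.2, ‖g (t, x t) - g (t, y' t)‖)
      (fun x hx hxy => hg q j x _ hx (modCurves_subset_modSet _ hy') hxy)
      (hy.mono fun _ hn => modCurves_subset_modSet _ hn) hyy'.tendstoUniformlyOn
  have hdiff := (tendsto_integral_norm_sub_of_tendsto_car hu j q).comp
    (tendsto_id.prodMk (tendsto_principal.2 hy))
  refine squeeze_zero' (Eventually.of_forall fun _ => integral_nonneg fun _ => norm_nonneg _) ?_
    (add_zero (0 : ℝ) ▸ hdiff.add hcurve)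
  filter_upwards [hy] with n hn
  have hi (k k' : Car N V) {z z' : ℝ → Euc N} (hz : Continuous z) (hz' : Continuous z') :
      IntegrableOn (fun t => ‖k (t, z t) - k' (t, z' t)‖) (Icc (q.1 : ℝ) q.2) :=
    (locallyIntegrable_norm ((k.locallyIntegrable_comp hz).sub
      (k'.locallyIntegrable_comp hz'))).integrableOn_isCompact isCompact_Icc
  simp only [Function.comp_apply, id_eq, Car.sub_apply]
  rw [← integral_add (hi (u n) g hn.1 hn.1) (hi g g hn.1 hy'.1)]
  exact integral_mono (hi (u n) g hn.1 hy'.1) ((hi (u n) g hn.1 hn.1).add (hi g g hn.1 hy'.1))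
    fun t => norm_sub_le_norm_sub_add_norm_sub _ _ _

end CarV

lemma EventuallyEquiintegrable.of_tendsto_integral_norm_sub {E : Type*} [NormedAddCommGroup E]
    {A : ι → ℝ → E} {B : ℝ → E} (hA : ∀ᶠ n in F, LocallyIntegrable (A n))
    (hB : LocallyIntegrable B)
    (h : ∀ M : ℕ, Tendsto (fun n => ∫ t in Icc (-(M : ℝ)) M, ‖A n t - B t‖) F (𝓝 0)) :
    EventuallyEquiintegrable F A := by
  intro r ε hε
  obtain ⟨δ, hδ, hshort⟩ := exists_forall_abs_integral_norm_le hB r (half_pos hε)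
  obtain ⟨M, hM⟩ := exists_nat_ge r
  refine ⟨δ, hδ, ?_⟩
  filter_upwards [hA, (h M).eventually_le_const (half_pos hε)] with n hn hsmall s hs t ht hst
  have hdiff : |∫ u in s..t, ‖A n u - B u‖| ≤ ε / 2 := by
    have hsub : uIoc s t ⊆ Icc (-(M : ℝ)) M := uIoc_subset_uIcc.trans
      ((uIcc_subset_Icc hs ht).trans (Icc_subset_Icc (neg_le_neg hM) hM))
    refine (intervalIntegral.norm_integral_le_integral_norm_uIoc
      (f := fun u => ‖A n u - B u‖)).trans (le_trans ?_ hsmall)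
    simp only [norm_norm]
    exact setIntegral_mono_set
      ((locallyIntegrable_norm (hn.sub hB)).integrableOn_isCompact isCompact_Icc)
      (Eventually.of_forall fun _ => norm_nonneg _) hsub.eventuallyLE
  have hAB : IntervalIntegrable (fun u => ‖A n u - B u‖) volume s t :=
    intervalIntegrable_of_locallyIntegrable (locallyIntegrable_norm (hn.sub hB)) s t
  have hB' := intervalIntegrable_of_locallyIntegrable (locallyIntegrable_norm hB) s t
  calc |∫ u in s..t, ‖A n u‖| ≤ |∫ u in s..t, (‖A n u - B u‖ + ‖B u‖)| :=
        intervalIntegral.norm_integral_le_abs_of_norm_le (f := fun u => ‖A n u‖)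
          (Eventually.of_forall fun u => by
            rw [norm_norm]
            exact norm_le_norm_sub_add _ _) (hAB.add hB')
    _ ≤ |∫ u in s..t, ‖A n u - B u‖| + |∫ u in s..t, ‖B u‖| := by
        rw [intervalIntegral.integral_add hAB hB']
        exact abs_add_le _ _
    _ ≤ ε := (add_le_add hdiff (hshort s hs t ht hst)).trans_eq (add_halves ε)

end Coefficients

section FundamentalMatrix

variable {N : ℕ} {mode : Mode} {Θ ρ : ℕ → ℝ → ℝ} {ι : Type*} {F : Filter ι} {ω : ι → Triple N}
  {ω' : Triple N}

/-- Convergence in `Ω` along a filter, together with the properties of the triples and of the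
moduli under which the fundamental matrices converge as well. -/
structure ConvergesTo (mode : Mode) (Θ ρ : ℕ → ℝ → ℝ) (F : Filter ι) (ω : ι → Triple N)
    (ω' : Triple N) : Prop where
  modulus : ∀ j, IsModulus (Θ j)
  modulus' : mode = .weak → ∀ j, IsModulus (ρ j)
  regular : ∀ᶠ n in F, IsRegular mode Θ ρ (ω n)
  regular' : IsRegular mode Θ ρ ω'
  isThetaC : IsThetaC mode Θ ω'.2.1
  tendsto : Tendsto ω F (@nhds _ (tripleTopology mode Θ N) ω')

namespace ConvergesTo

lemma mono {F' : Filter ι} (h : ConvergesTo mode Θ ρ F ω ω') (hF : F' ≤ F) :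
    ConvergesTo mode Θ ρ F' ω ω' :=
  { h with
    regular := hF h.regular
    tendsto := h.tendsto.mono_left hF }

lemma tendsto_fst (h : ConvergesTo mode Θ ρ F ω ω') :
    Tendsto (fun n => (ω n).1) F (@nhds _ (carTopology mode Θ N (Euc N)) ω'.1) :=
  letI := carTopology mode Θ N (Euc N)
  letI := carTopology mode Θ N (Mat N)
  (continuous_fst.tendsto ω').comp h.tendsto

lemma tendsto_snd (h : ConvergesTo mode Θ ρ F ω ω') :
    Tendsto (fun n => (ω n).2.1) F (@nhds _ (carTopology mode Θ N (Mat N)) ω'.2.1) :=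
  letI := carTopology mode Θ N (Euc N)
  letI := carTopology mode Θ N (Mat N)
  ((continuous_fst.comp continuous_snd).tendsto ω').comp h.tendsto

lemma tendsto_thd (h : ConvergesTo mode Θ ρ F ω ω') :
    Tendsto (fun n => (ω n).2.2) F (𝓝 ω'.2.2) :=
  letI := carTopology mode Θ N (Euc N)
  letI := carTopology mode Θ N (Mat N)
  ((continuous_snd.comp continuous_snd).tendsto ω').comp h.tendsto

lemma eventually_norm_traj_sub_le (h : ConvergesTo mode Θ ρ F ω ω') (r : ℝ) {ε : ℝ} (hε : 0 < ε) :
    ∀ᶠ n in F, ∀ t, |t| ≤ r → ‖(ω n).traj t - ω'.traj t‖ ≤ ε :=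
  CarathODE.eventually_norm_traj_sub_le h.modulus h.regular h.regular' h.tendsto_fst h.tendsto_thd
    r hε

lemma exists_modCurves (h : ConvergesTo mode Θ ρ F ω ω') {r : ℝ} (hr : 0 ≤ r) :
    ∃ (j : ℕ) (y : ι → ℝ → Euc N) (y' : ℝ → Euc N), y' ∈ modCurves N Θ j ∧
      (∀ᶠ n in F, y n ∈ modCurves N Θ j) ∧ TendstoUniformly y y' F ∧
      ∀ t ∈ Icc (-r) r, y' t = ω'.traj t ∧ ∀ n, y n t = (ω n).traj t := by
  obtain ⟨j, hj⟩ := h.regular'.exists_norm_traj_add_one_le r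
  have hle : -r ≤ r := neg_le_self hr
  refine ⟨j, fun n => IccExtend hle fun t : Icc (-r) r => (ω n).traj t,
    IccExtend hle fun t : Icc (-r) r => ω'.traj t, ?_, ?_, ?_,
    fun t ht => ⟨IccExtend_of_mem _ _ ht, fun n => IccExtend_of_mem _ _ ht⟩⟩
  · exact h.regular'.IccExtend_traj_mem_modCurves (h.modulus j) hle fun t ht =>
      mem_closedBall_of_norm_sub_le_one (by simp) (hj t (abs_le.2 ht))
  · filter_upwards [h.regular, h.eventually_norm_traj_sub_le r one_pos] with n hn hclose
    exact hn.IccExtend_traj_mem_modCurves (h.modulus j) hle fun t ht =>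
      mem_closedBall_of_norm_sub_le_one (hclose t (abs_le.2 ht)) (hj t (abs_le.2 ht))
  · refine Metric.tendstoUniformly_iff.2 fun ε hε => ?_
    filter_upwards [h.eventually_norm_traj_sub_le r (half_pos hε)] with n hn t
    rw [dist_comm, dist_eq_norm]
    exact (hn _ (abs_le.2 (projIcc _ _ hle t).2)).trans_lt (half_lt_self hε)

lemma tendsto_integral_coeff (h : ConvergesTo mode Θ ρ F ω ω') (q : ℚ) :
    Tendsto (fun n => ∫ s in (0 : ℝ)..q, (ω n).coeff s) F
      (𝓝 (∫ s in (0 : ℝ)..q, ω'.coeff s)) := by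
  obtain ⟨j, y, y', hy', hy, hyy', heq⟩ := h.exists_modCurves (abs_nonneg (q : ℝ))
  have hlim := tendsto_integral_comp_of_tendsto_car h.tendsto_snd h.isThetaC hy hy' hyy' 0 q
  have hmem {s : ℝ} (hs : s ∈ uIcc (0 : ℝ) q) : s ∈ Icc (-|(q : ℝ)|) |(q : ℝ)| :=
    uIcc_subset_Icc ⟨neg_nonpos.2 (abs_nonneg _), abs_nonneg _⟩ ⟨neg_abs_le _, le_abs_self _⟩ hs
  rw [Rat.cast_zero, intervalIntegral.integral_congr (g := ω'.coeff) fun s hs => by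
    simp only [(heq s (hmem hs)).1, Triple.coeff]] at hlim
  exact hlim.congr fun n => intervalIntegral.integral_congr fun s hs => by
    simp only [(heq s (hmem hs)).2, Triple.coeff]

lemma tendsto_integral_norm_coeff_sub (h : ConvergesTo .strong Θ ρ F ω ω') (M : ℕ) :
    Tendsto (fun n => ∫ s in Icc (-(M : ℝ)) M, ‖(ω n).coeff s - ω'.coeff s‖) F (𝓝 0) := by
  obtain ⟨j, y, y', hy', hy, hyy', heq⟩ := h.exists_modCurves (Nat.cast_nonneg M)
  have hlim := tendsto_integral_norm_sub_comp_of_tendsto_car h.tendsto_snd h.isThetaC hy hy' hyy'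
    (-M, M)
  push_cast at hlim
  exact hlim.congr fun n => setIntegral_congr_fun measurableSet_Icc fun s hs => by
    simp only [(heq s hs).1, (heq s hs).2, Triple.coeff]

lemma eventuallyEquiintegrable_coeff (h : ConvergesTo mode Θ ρ F ω ω') :
    EventuallyEquiintegrable F fun n => (ω n).coeff := by
  cases mode with
  | strong =>
    exact .of_tendsto_integral_norm_sub (h.regular.mono fun _ hn => hn.locallyIntegrable_coeff)
      h.regular'.locallyIntegrable_coeff h.tendsto_integral_norm_coeff_sub
  | weak =>
    intro r ε hε
    obtain ⟨j, y, y', -, hy, -, heq⟩ := h.exists_modCurves (abs_nonneg r)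
    obtain ⟨δ, hδ, hsmall⟩ := (h.modulus' rfl j).exists_forall_abs_le hε
    refine ⟨δ, hδ, ?_⟩
    filter_upwards [h.regular, hy] with n hn hyn s hs t ht hst
    obtain ⟨m, hm, hmρ, hbound⟩ := hn.exists_bound rfl j
    have hcongr : ∫ u in s..t, ‖(ω n).coeff u‖ = ∫ u in s..t, ‖(ω n).2.1 (u, y n u)‖ :=
      intervalIntegral.integral_congr fun u hu => by
        have hur := uIcc_subset_Icc hs ht hu
        simp only [(heq u ⟨(neg_le_neg (le_abs_self r)).trans hur.1,
          hur.2.trans (le_abs_self r)⟩).2, Triple.coeff]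
    rw [hcongr]
    exact (abs_integral_norm_le_of_ae_le hm hmρ (hbound _ hyn) s t).trans (hsmall s t hst)

lemma tendsto_fundMat (h : ConvergesTo mode Θ ρ F ω ω') (t : ℝ) :
    Tendsto (fun n => fundMat t (ω n)) F (𝓝 (fundMat t ω')) :=
  tendsto_isPrincipal (Φ := fun n t => fundMat t (ω n)) (Ψ := fun t => fundMat t ω')
    (h.regular.mono fun _ hn => hn.locallyIntegrable_coeff) h.regular'.locallyIntegrable_coeff
    (h.regular.mono fun _ hn => hn.isPrincipal_fundMat) h.regular'.isPrincipal_fundMat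
    h.tendsto_integral_coeff h.eventuallyEquiintegrable_coeff t

lemma tendsto_inverse_fundMat (h : ConvergesTo mode Θ ρ F ω ω') (t : ℝ) :
    Tendsto (fun n => Ring.inverse (fundMat t (ω n))) F (𝓝 (Ring.inverse (fundMat t ω'))) := by
  obtain ⟨u, hu⟩ := h.regular'.isUnit_fundMat t
  exact (hu ▸ NormedRing.inverse_continuousAt u).tendsto.comp (h.tendsto_fundMat t)

end ConvergesTo

end FundamentalMatrix

section Hull

variable {N : ℕ} {mode : Mode}

lemma exists_ultrafilter_tendsto_of_mem_closure_range {X Y : Type*} [TopologicalSpace Y]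
    {u : X → Y} {y : Y} (hy : y ∈ closure (range u)) : ∃ U : Ultrafilter X, Tendsto u U (𝓝 y) :=
  have hcluster : MapClusterPt y ⊤ u := by
    rwa [MapClusterPt, map_top, ← mem_closure_iff_clusterPt]
  let ⟨U, _, hU⟩ := mapClusterPt_iff_ultrafilter.1 hcluster
  ⟨U, hU⟩

lemma exists_ultrafilter_tendsto_shift_of_mem_hull {f : Car N (Euc N)} {F : Car N (Mat N)}
    {p : Car N (Euc N) × Car N (Mat N)} (hp : p ∈ hull mode f F) :
    ∃ U : Ultrafilter ℝ,
      Tendsto (fun τ => f.shift τ) U (@nhds _ (carTopology mode (theta f) N (Euc N)) p.1) ∧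
      Tendsto (fun τ => F.shift τ) U (@nhds _ (carTopology mode (theta f) N (Mat N)) p.2) :=
  letI := carTopology mode (theta f) N (Euc N)
  letI := carTopology mode (theta f) N (Mat N)
  let ⟨U, hU⟩ := exists_ultrafilter_tendsto_of_mem_closure_range hp.2.2
  ⟨U, (continuous_fst.tendsto p).comp hU, (continuous_snd.tendsto p).comp hU⟩

lemma isRegular_of_mem_Omega {f : Car N (Euc N)} {F : Car N (Mat N)} (hf : IsSC f)
    (hf_bounds : HasEquicontinuousMBounds f) (hF : IsSC F)
    (hF_bounds : mode = .weak → HasEquicontinuousMBounds F)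
    (hglobal : ∀ p ∈ hull mode f F, ∀ x₀ : Euc N, ∃ x, IsSolution p.1 x₀ x)
    {ω : Triple N} (hω : ω ∈ Omega mode f F) : IsRegular mode (theta f) (theta F) ω := by
  obtain ⟨U, hUf, hUF⟩ := exists_ultrafilter_tendsto_shift_of_mem_hull hω
  have hLC : IsLC ω.1 := hω.1
  exact {
    isLC := hLC
    exists_isSolution := hglobal _ hω _
    exists_isMBound j := hf_bounds.exists_isMBound_of_tendsto_shift hf hLC.isSC
      (hf_bounds.isModulus_theta hf j) hUf
    exists_bound hmode := (hF_bounds hmode).exists_bound_of_tendsto_shift hF hUF }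

end Hull

section Dichotomy

variable {N : ℕ} {mode : Mode} {Θ ρ : ℕ → ℝ → ℝ} {ω ω' : Triple N} {P Q : Mat N} {K α : ℝ}
  {J : Set ℝ}

/-- The estimates of an exponential dichotomy on `J` of the single system `ẏ = A(ω_t) y`, with
projection `P` and constants `K` and `α`. -/
def DichotomyBound (J : Set ℝ) (ω : Triple N) (P : Mat N) (K α : ℝ) : Prop :=
  ∀ s ∈ J, ∀ t ∈ J,
    (s ≤ t → ‖fundMat t ω * P * Ring.inverse (fundMat s ω)‖ ≤ K * Real.exp (-α * (t - s))) ∧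
    (t ≤ s → ‖fundMat t ω * (1 - P) * Ring.inverse (fundMat s ω)‖ ≤ K * Real.exp (α * (t - s)))

lemma DichotomyBound.norm_le (hω : IsWellPosed ω) (h0 : (0 : ℝ) ∈ J)
    (h : DichotomyBound J ω P K α) : ‖P‖ ≤ K := by
  simpa only [hω.fundMat_zero, one_mul, Ring.inverse_one, mul_one, sub_zero, mul_zero,
    Real.exp_zero] using (h 0 h0 0 h0).1 le_rfl

lemma eq_zero_of_norm_le_mul_exp {E : Type*} [NormedAddCommGroup E] {X : E} {C β : ℝ} (hβ : 0 < β)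
    (h : ∀ t, 0 ≤ t → ‖X‖ ≤ C * Real.exp (-(β * t))) : X = 0 := by
  have hlim : Tendsto (fun t : ℝ => C * Real.exp (-(β * t))) atTop (𝓝 (C * 0)) :=
    (Real.tendsto_exp_neg_atTop_nhds_zero.comp (tendsto_id.const_mul_atTop hβ)).const_mul C
  rw [mul_zero] at hlim
  exact norm_le_zero_iff.1 (ge_of_tendsto hlim ((eventually_ge_atTop 0).mono h))

lemma IsWellPosed.norm_mul_le_fundMat_mul (hω : IsWellPosed ω) (t : ℝ) (X Y : Mat N) :
    ‖X * Y‖ ≤ ‖fundMat 0 ω * X * Ring.inverse (fundMat t ω)‖ *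
      ‖fundMat t ω * Y * Ring.inverse (fundMat 0 ω)‖ := by
  have hXY : X * Y = (X * Ring.inverse (fundMat t ω)) * (fundMat t ω * Y) := by
    rw [mul_assoc, Ring.inverse_mul_cancel_left _ _ (hω.isUnit_fundMat t)]
  rw [hω.fundMat_zero, Ring.inverse_one, mul_one, one_mul, hXY]
  exact norm_mul_le _ _

lemma DichotomyBound.unique (hω : IsWellPosed ω) (hα : 0 < α)
    (hP : DichotomyBound univ ω P K α) (hQ : DichotomyBound univ ω Q K α) : P = Q := by
  have hexp (t : ℝ) :
      K * Real.exp (-(α * t)) * (K * Real.exp (-(α * t))) = K * K * Real.exp (-(2 * α * t)) := by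
    rw [mul_mul_mul_comm, ← Real.exp_add, ← neg_add, two_mul, add_mul]
  have hzero {X Y : Mat N} {σ : ℝ → ℝ}
      (hX : ∀ t, 0 ≤ t → ‖fundMat 0 ω * X * Ring.inverse (fundMat (σ t) ω)‖ ≤
        K * Real.exp (-(α * t)))
      (hY : ∀ t, 0 ≤ t → ‖fundMat (σ t) ω * Y * Ring.inverse (fundMat 0 ω)‖ ≤
        K * Real.exp (-(α * t))) : X * Y = 0 :=
    eq_zero_of_norm_le_mul_exp (mul_pos two_pos hα) fun t ht =>
      ((hω.norm_mul_le_fundMat_mul (σ t) X Y).trans (mul_le_mul (hX t ht) (hY t ht) (norm_nonneg _)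
        ((norm_nonneg _).trans (hX t ht)))).trans_eq (hexp t)
  have hPQ : (1 - P) * Q = 0 := hzero (σ := id)
    (fun t ht => by simpa using (hP t trivial 0 trivial).2 ht)
    (fun t ht => by simpa using (hQ 0 trivial t trivial).1 ht)
  have hQP : P * (1 - Q) = 0 := hzero (σ := Neg.neg)
    (fun t ht => by simpa using (hP (-t) trivial 0 trivial).1 (neg_nonpos.2 ht))
    (fun t ht => by simpa using (hQ 0 trivial (-t) trivial).2 (neg_nonpos.2 ht))
  rw [sub_mul, one_mul, sub_eq_zero] at hPQ
  rw [mul_sub, mul_one, sub_eq_zero] at hQP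
  exact hQP.trans hPQ.symm

lemma ConvergesTo.dichotomyBound {ι : Type*} {F : Filter ι} [F.NeBot] {ω : ι → Triple N}
    {P : ι → Mat N} {P' : Mat N} (h : ConvergesTo mode Θ ρ F ω ω') (hP : Tendsto P F (𝓝 P'))
    (hb : ∀ s t, ∀ᶠ n in F, DichotomyBound {s, t} (ω n) (P n) K α) :
    DichotomyBound univ ω' P' K α := by
  intro s _ t _
  have hlim {X : ι → Mat N} {X' : Mat N} (hX : Tendsto X F (𝓝 X')) :
      Tendsto (fun n => ‖fundMat t (ω n) * X n * Ring.inverse (fundMat s (ω n))‖) F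
        (𝓝 ‖fundMat t ω' * X' * Ring.inverse (fundMat s ω')‖) :=
    (((h.tendsto_fundMat t).mul hX).mul (h.tendsto_inverse_fundMat s)).norm
  have hst : s ∈ ({s, t} : Set ℝ) ∧ t ∈ ({s, t} : Set ℝ) := ⟨.inl rfl, .inr rfl⟩
  exact ⟨fun hle => le_of_tendsto (hlim hP)
      ((hb s t).mono fun n hn => (hn s hst.1 t hst.2).1 hle),
    fun hle => le_of_tendsto (hlim (hP.const_sub 1))
      ((hb s t).mono fun n hn => (hn s hst.1 t hst.2).2 hle)⟩

/-- The projection `Φ(τ, ω) P Φ(τ, ω)⁻¹`, which plays at `ω_τ` the role that `P` plays at `ω`. -/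
noncomputable def transport (τ : ℝ) (ω : Triple N) (P : Mat N) : Mat N :=
  fundMat τ ω * P * Ring.inverse (fundMat τ ω)

namespace IsWellPosed

lemma inverse_fundMat (h : IsWellPosed ω) (s : ℝ) :
    Ring.inverse (fundMat s ω) = fundMat (-s) (CarathODE.baseFlow s ω) :=
  Ring.inverse_unit ⟨_, _, h.fundMat_mul_fundMat_neg s, h.fundMat_neg_mul_fundMat s⟩

lemma inverse_fundMat_add (h : IsWellPosed ω) (s τ : ℝ) :
    Ring.inverse (fundMat (s + τ) ω) =
      Ring.inverse (fundMat τ ω) * Ring.inverse (fundMat s (CarathODE.baseFlow τ ω)) := by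
  have hadd := (h.baseFlow (s + τ)).fundMat_add (-τ) (-s)
  rw [h.baseFlow_baseFlow, neg_add_cancel_left] at hadd
  rw [h.inverse_fundMat, h.inverse_fundMat, (h.baseFlow τ).inverse_fundMat, h.baseFlow_baseFlow,
    neg_add_rev, hadd]

lemma fundMat_mul_transport_mul_inverse (h : IsWellPosed ω) (τ s t : ℝ) (P : Mat N) :
    fundMat t (CarathODE.baseFlow τ ω) * transport τ ω P *
        Ring.inverse (fundMat s (CarathODE.baseFlow τ ω)) =
      fundMat (t + τ) ω * P * Ring.inverse (fundMat (s + τ) ω) := by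
  simp only [transport, h.fundMat_add t τ, h.inverse_fundMat_add s τ, mul_assoc]

lemma isIdempotentElem_transport (h : IsWellPosed ω) (τ : ℝ) (hP : IsIdempotentElem P) :
    IsIdempotentElem (transport τ ω P) := by
  have hcancel := Ring.inverse_mul_cancel _ (h.isUnit_fundMat τ)
  calc transport τ ω P * transport τ ω P
      = fundMat τ ω * P * (Ring.inverse (fundMat τ ω) * fundMat τ ω) * P *
          Ring.inverse (fundMat τ ω) := by simp only [transport, mul_assoc]
    _ = fundMat τ ω * (P * P) * Ring.inverse (fundMat τ ω) := by
        rw [hcancel, mul_one, mul_assoc (fundMat τ ω) P P]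
    _ = transport τ ω P := by rw [hP.eq, transport]

lemma transport_one_sub (h : IsWellPosed ω) (τ : ℝ) (P : Mat N) :
    transport τ ω (1 - P) = 1 - transport τ ω P := by
  rw [transport, mul_sub, sub_mul, mul_one, Ring.mul_inverse_cancel _ (h.isUnit_fundMat τ),
    transport]

end IsWellPosed

lemma DichotomyBound.transport (hω : IsWellPosed ω) (h : DichotomyBound J ω P K α) {τ : ℝ}
    {I : Set ℝ} (hI : ∀ t ∈ I, t + τ ∈ J) :
    DichotomyBound I (baseFlow τ ω) (transport τ ω P) K α := by
  intro s hs t ht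
  rw [← hω.transport_one_sub, hω.fundMat_mul_transport_mul_inverse,
    hω.fundMat_mul_transport_mul_inverse]
  simpa only [add_le_add_iff_right, add_sub_add_right_eq_sub] using h _ (hI s hs) _ (hI t ht)

lemma exists_tendsto_ultrafilter_of_norm_le {ι E : Type*} [SeminormedAddCommGroup E] [ProperSpace E]
    {U : Ultrafilter ι} {x : ι → E} {C : ℝ} (h : ∀ᶠ n in U, ‖x n‖ ≤ C) :
    ∃ y, Tendsto x U (𝓝 y) :=
  let ⟨y, _, hy⟩ := (isCompact_closedBall (0 : E) C).ultrafilter_le_nhds (U.map x)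
    (tendsto_principal.2 (h.mono fun _ hn => mem_closedBall_zero_iff.2 hn))
  ⟨y, hy⟩

lemma exists_dichotomyBound_of_convergesTo {l : Filter ℝ} [l.NeBot] (hω : IsWellPosed ω)
    (h : ConvergesTo mode Θ ρ l (fun τ => baseFlow τ ω) ω') (hl : ∀ t, ∀ᶠ τ in l, t + τ ∈ J)
    (hP : IsIdempotentElem P) (hb : DichotomyBound J ω P K α) :
    ∃ P', IsIdempotentElem P' ∧ DichotomyBound univ ω' P' K α := by
  have hbound (s t : ℝ) :
      ∀ᶠ τ in l, DichotomyBound {s, t} (baseFlow τ ω) (transport τ ω P) K α := by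
    filter_upwards [hl s, hl t] with τ hs ht
    refine hb.transport hω ?_
    rintro r (rfl | rfl)
    exacts [hs, ht]
  have hU : (Ultrafilter.of l : Filter ℝ) ≤ l := Ultrafilter.of_le l
  obtain ⟨P', hP'⟩ : ∃ P', Tendsto (fun τ => transport τ ω P) (Ultrafilter.of l) (𝓝 P') :=
    exists_tendsto_ultrafilter_of_norm_le (hU ((hbound 0 0).mono fun τ hτ =>
      hτ.norm_le (hω.baseFlow τ) (.inl rfl)))
  exact ⟨P', tendsto_nhds_unique
      ((hP'.mul hP').congr fun τ => hω.isIdempotentElem_transport τ hP) hP',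
    (h.mono hU).dichotomyBound hP' fun s t => hU (hbound s t)⟩

lemma hasExpDichotomy_univ_of_forall {Δ : Set (Triple N)} (hΘ : ∀ j, IsModulus (Θ j))
    (hρ : mode = .weak → ∀ j, IsModulus (ρ j)) (hΔ : ∀ ω ∈ Δ, IsRegular mode Θ ρ ω)
    (hΔC : ∀ ω ∈ Δ, IsThetaC mode Θ ω.2.1) (hK : 1 ≤ K) (hα : 0 < α)
    (h : ∀ ω ∈ Δ, ∃ P, IsIdempotentElem P ∧ DichotomyBound univ ω P K α) :
    HasExpDichotomy mode Θ univ Δ := by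
  classical
  choose! P hP hb using h
  refine ⟨P, ?_, hP, K, hK, α, hα, fun s hs t ht ω hω => hb ω hω s hs t ht⟩
  let _ := tripleTopology mode Θ N
  -- Bounded projections have ultrafilter limits, and uniqueness identifies them with `P ω₀`.
  refine fun ω₀ hω₀ => (tendsto_iff_ultrafilter _ _ _).2 fun U hU => ?_
  have hUΔ : ∀ᶠ ω in U, ω ∈ Δ := hU self_mem_nhdsWithin
  have hconv : ConvergesTo mode Θ ρ (U : Filter (Triple N)) id ω₀ :=
    ⟨hΘ, hρ, hUΔ.mono hΔ, hΔ _ hω₀, hΔC _ hω₀, hU.trans inf_le_left⟩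
  obtain ⟨P', hP'⟩ : ∃ P', Tendsto P U (𝓝 P') := exists_tendsto_ultrafilter_of_norm_le
    (hUΔ.mono fun ω hω => (hb ω hω).norm_le (hΔ ω hω).toIsWellPosed (mem_univ _))
  have hlim := hconv.dichotomyBound hP' fun s t => hUΔ.mono fun ω hω s' _ t' _ =>
    hb ω hω s' trivial t' trivial
  rwa [hlim.unique (hΔ _ hω₀).toIsWellPosed hα (hb _ hω₀)] at hP'

theorem HasExpDichotomy.univ_of_tendsto_baseFlow {Δ : Set (Triple N)}
    (hΘ : ∀ j, IsModulus (Θ j)) (hρ : mode = .weak → ∀ j, IsModulus (ρ j))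
    (hω : IsRegular mode Θ ρ ω) (hΔ : ∀ ω' ∈ Δ, IsRegular mode Θ ρ ω')
    (hΔC : ∀ ω' ∈ Δ, IsThetaC mode Θ ω'.2.1) (h : HasExpDichotomy mode Θ J {ω})
    (hlim : ∀ ω' ∈ Δ, ∃ l : Filter ℝ, l.NeBot ∧ (∀ t, ∀ᶠ τ in l, t + τ ∈ J) ∧
      Tendsto (fun τ => baseFlow τ ω) l (@nhds _ (tripleTopology mode Θ N) ω')) :
    HasExpDichotomy mode Θ univ Δ := by
  obtain ⟨P, -, hP, K, hK, α, hα, hb⟩ := h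
  refine hasExpDichotomy_univ_of_forall hΘ hρ hΔ hΔC hK hα fun ω' hω' => ?_
  obtain ⟨l, hl, hlJ, hlω'⟩ := hlim ω' hω'
  exact exists_dichotomyBound_of_convergesTo hω.toIsWellPosed
    ⟨hΘ, hρ, Eventually.of_forall hω.baseFlow, hΔ ω' hω', hΔC ω' hω', hlω'⟩ hlJ (hP ω rfl)
    fun s hs t ht => hb s hs t ht ω rfl

end Dichotomy

end CarathODE

theorem mainTheorem5 (N : ℕ) (mode : CarathODE.Mode)
    (f : CarathODE.Car N (CarathODE.Euc N)) (F : CarathODE.Car N (CarathODE.Mat N))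
    (hf : CarathODE.IsLC f)
    (hf_bounds : CarathODE.HasEquicontinuousMBounds f)
    (hF : CarathODE.IsSC F)
    (hJ : CarathODE.IsJacobian f F)
    (hF_bounds : mode = CarathODE.Mode.weak → CarathODE.HasEquicontinuousMBounds F)
    (hglobal : ∀ p ∈ CarathODE.hull mode f F, ∀ x₀ : CarathODE.Euc N,
      ∃ x, CarathODE.IsSolution p.1 x₀ x)
    (ω : CarathODE.Triple N) (hω : ω ∈ CarathODE.Omega mode f F) :
    (CarathODE.HasExpDichotomy mode (CarathODE.theta f) (Set.Iic 0) {ω} →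
      CarathODE.HasExpDichotomy mode (CarathODE.theta f) Set.univ
        (CarathODE.alphaLimit mode f F ω)) ∧
    (CarathODE.HasExpDichotomy mode (CarathODE.theta f) (Set.Ici 0) {ω} →
      CarathODE.HasExpDichotomy mode (CarathODE.theta f) Set.univ
        (CarathODE.omegaLimit mode f F ω)) ∧
    (CarathODE.HasExpDichotomy mode (CarathODE.theta f) Set.univ {ω} →
      CarathODE.HasExpDichotomy mode (CarathODE.theta f) Set.univ
        (CarathODE.orbitHull mode f F ω)) := by
  have hΘ := hf_bounds.isModulus_theta hf.isSC
  have hregular : ∀ ω' ∈ CarathODE.Omega mode f F, _ := fun _ =>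
    CarathODE.isRegular_of_mem_Omega hf.isSC hf_bounds hF hF_bounds hglobal
  refine ⟨fun h => ?_, fun h => ?_, fun h => ?_⟩ <;>
    refine h.univ_of_tendsto_baseFlow hΘ (fun hmode => (hF_bounds hmode).isModulus_theta hF)
      (hregular ω hω) (fun ω' hω' => hregular ω' hω'.1) (fun _ hω' => hω'.1.2.1) ?_
  · rintro ω' ⟨-, t, ht, hlim⟩
    exact ⟨map t atTop, inferInstance,
      fun s => (tendsto_atBot_add_const_left _ s ht).eventually (Iic_mem_atBot 0), hlim⟩
  · rintro ω' ⟨-, t, ht, hlim⟩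
    exact ⟨map t atTop, inferInstance,
      fun s => (tendsto_atTop_add_const_left _ s ht).eventually (Ici_mem_atTop 0), hlim⟩
  · rintro ω' ⟨-, hclosure⟩
    let _ := CarathODE.tripleTopology mode (CarathODE.theta f) N
    obtain ⟨U, hU⟩ := CarathODE.exists_ultrafilter_tendsto_of_mem_closure_range hclosure
    exact ⟨U, inferInstance, fun _ => Eventually.of_forall fun _ => mem_univ _, hU⟩
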